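/- **Setting.** Let $f_1,\dots,f_n:\mathbb R^{d_x}\times\mathbb R^{d_y}\to\mathbb R$ ($n\ge 1$) be continuously differentiable, $F=\frac1n\sum_{i=1}^n f_i$, $\omega_i(x,y)=(\nabla_x f_i(x,y),-\nabla_y f_i(x,y))$ and $\nu=\frac1n\sum_{i=1}^n\omega_i$. Let $l,\mu_1,\mu_2,\sigma>0$ with $\mu_1\le l$ and $\mu_2\le l$ and assume, with Euclidean norms: * every $\omega_i$ is $l$-Lipschitz; * for all $x,y$ the sets $\arg\max_{\tilde y}F(x,\tilde y)$ and $\arg\min_{\tilde x}F(\tilde x,y)$ are non-empty, $\|\nabla_xF(x,y)\|^2\ge 2\mu_1[F(x,y)-\min_{\tilde x}F(\tilde x,y)]$ and $\|\nabla_yF(x,y)\|^2\ge 2\mu_2[\max_{\tilde y}F(x,\tilde y)-F(x,y)]$; * $F$ has a global minimax point, i.e. a point $(x^*,y^*)$ such that $x^*$ minimises $\Phi(x)=\max_yF(x,y)$ and $y^*$ maximises $F(x^*,\cdot)$; * $\frac1n\sum_{i=1}^n\|\omega_i(z)-\nu(z)\|^2\le\sigma^2$ for all $z\in\mathbb R^{d_x}\times\mathbb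 R^{d_y}$. Put $\Phi^*=\min_x\Phi(x)$, $V(x,y)=[\Phi(x)-\Phi^*]+\frac1{10}[\Phi(x)-F(x,y)]$, $\kappa=\max\{l/\mu_1,l/\mu_2\}$ and $\eta=\frac{73l^2}{2\mu_2^2}$. **Algorithm.** Given step-sizes $\alpha>0$ and $\beta=\eta\alpha$ and a start $z^1_0=z_0=(x_0,y_0)$, epoch $k=1,\dots,K$ uses two permutations $\tau_k,\pi_k$ of $\{1,\dots,n\}$: for $i=1,\dots,n$, $x^k_i=x^k_{i-1}-\alpha\nabla_xf_{\tau_k(i)}(x^k_{i-1},y^k_0)$; then for $i=1,\dots,n$, $y^k_i=y^k_{i-1}+\beta\nabla_yf_{\pi_k(i)}(x^k_n,y^k_{i-1})$; and $z^{k+1}_0=(x^k_n,y^k_n)$. In AGDA-RR all $\tau_k,\pi_k$ are independent and uniformly distributed; in AGDA-AS they are chosen by an adversary. **Theorem.** There are numerical constants $c,\hat c>0$ such that, in the above setting, for every $z_0$ and every $K\ge1$: (i) For every $0<\alpha\le\frac1{5\eta nl}$, AGDA-RR satisfies $$\mathbb E[V(z^{K+1}_0)]\le(1-\tfrac{\mu_1n\alpha}2)^KV(z_0)+\frac{0.42\,n\alpha^2l^2\sigma^2(3+\eta^3)}{\mu_1},$$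 and AGDA-AS satisfies $$\max_{\tau_1,\pi_1,\dots,\tau_K,\pi_K}V(z^{K+1}_0)\le(1-\tfrac{\mu_1n\alpha}2)^KV(z_0)+\frac{2n^2\alpha^2l^2\sigma^2(2+3\eta^3)}{\mu_1}.$$ (ii) There is a step-size $0<\alpha\le\frac1{5\eta nl}$ for which AGDA-RR satisfies, with $\Lambda=\log(\max\{V(z_0),1\}\,n^{1/2}K)$, $$\mathbb E[V(z^{K+1}_0)]\le e^{-K/(365\kappa^3)}V(z_0)+\frac{\mu_1+c\,\kappa^8\sigma^2\Lambda^2}{\mu_1nK^2};$$ if $\Lambda>0$, one may take $\alpha=\min\{\frac1{5\eta nl},\frac{4\Lambda}{\mu_1nK}\}$. (iii) There is a step-size $0<\alpha\le\frac1{5\eta nl}$ for which AGDA-AS satisfies, with $\hat\Lambda=\log(\max\{V(z_0),1\}\,K)$, $$\max_{\tau_1,\pi_1,\dots,\tau_K,\pi_K}V(z^{K+1}_0)\le e^{-K/(365\kappa^3)}V(z_0)+\frac{\mu_1+\hat c\,\kappa^8\sigma^2\hat\Lambda^2}{\mu_1K^2};$$ if $\hat\Lambda>0$, one may take $\alpha=\min\{\frac1{5\eta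 nl},\frac{4\hat\Lambda}{\mu_1nK}\}$. -/

import Mathlib

open scoped BigOperators

noncomputable section

namespace AGDA

/-- Euclidean space of dimension `d`. -/
abbrev E (d : ℕ) : Type := EuclideanSpace ℝ (Fin d)

/-- The joint space of pairs `z = (x, y)`, with the norm `‖z‖² = ‖x‖² + ‖y‖²`. -/
abbrev Z (dx dy : ℕ) : Type := WithLp 2 (E dx × E dy)

/-- The pair `(x, y)` as a point of the joint space. -/
def pair {dx dy : ℕ} (x : E dx) (y : E dy) : Z dx dy := WithLp.toLp 2 (x, y)

/-- Partial gradient in the first variable. -/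
def gradX {dx dy : ℕ} (g : E dx → E dy → ℝ) (x : E dx) (y : E dy) : E dx :=
  gradient (fun x' => g x' y) x

/-- Partial gradient in the second variable. -/
def gradY {dx dy : ℕ} (g : E dx → E dy → ℝ) (x : E dx) (y : E dy) : E dy :=
  gradient (fun y' => g x y') y

/-- The gradient operator `ω(x, y) = (∇ₓ g(x, y), -∇_y g(x, y))`. -/
def omega {dx dy : ℕ} (g : E dx → E dy → ℝ) (x : E dx) (y : E dy) : Z dx dy :=
  pair (gradX g x y) (-gradY g x y)

/-- The finite-sum objective `F = (1/n) ∑ᵢ fᵢ`. -/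
def objective {n dx dy : ℕ} (f : Fin n → E dx → E dy → ℝ) (x : E dx) (y : E dy) : ℝ :=
  (1 / (n : ℝ)) * ∑ i, f i x y

/-- The averaged gradient operator `ν = (1/n) ∑ᵢ ωᵢ`. -/
def nu {n dx dy : ℕ} (f : Fin n → E dx → E dy → ℝ) (x : E dx) (y : E dy) : Z dx dy :=
  (1 / (n : ℝ)) • ∑ i, omega (f i) x y

/-- The best response function `Φ(x) = max_y F(x, y)`. -/
def bestResponse {dx dy : ℕ} (F : E dx → E dy → ℝ) (x : E dx) : ℝ := ⨆ y, F x y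

/-- The minimax value `Φ* = min_x Φ(x)`. -/
def minimaxValue {dx dy : ℕ} (F : E dx → E dy → ℝ) : ℝ := ⨅ x, bestResponse F x

/-- The Lyapunov function `V_lam(x, y) = [Φ(x) - Φ*] + lam [Φ(x) - F(x, y)]`. -/
def lyapunov {dx dy : ℕ} (F : E dx → E dy → ℝ) (lam : ℝ) (x : E dx) (y : E dy) : ℝ :=
  (bestResponse F x - minimaxValue F) + lam * (bestResponse F x - F x y)

/-- `(x, y)` is a global minimax point: `x` minimises `Φ` and `y` maximises `F(x, ·)`. -/
def IsMinimaxPoint {dx dy : ℕ} (F : E dx → E dy → ℝ) (x : E dx) (y : E dy) : Prop :=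
  (∀ x', bestResponse F x ≤ bestResponse F x') ∧ (∀ y', F x y' ≤ F x y)

/-- Each component is continuously differentiable and `l`-smooth, that is, its gradient operator
is `l`-Lipschitz for the Euclidean norm of the joint space. -/
structure ComponentsSmooth {n dx dy : ℕ} (f : Fin n → E dx → E dy → ℝ) (l : ℝ) : Prop where
  contDiff : ∀ i, ContDiff ℝ 1 (fun p : E dx × E dy => f i p.1 p.2)
  lipschitz : ∀ i x₁ y₁ x₂ y₂,
    ‖omega (f i) x₂ y₂ - omega (f i) x₁ y₁‖ ≤ l * ‖pair x₂ y₂ - pair x₁ y₁‖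

/-- The two-sided Polyak-Łojasiewicz condition with positive constants `μ₁`, `μ₂`. -/
structure TwoSidedPL {dx dy : ℕ} (F : E dx → E dy → ℝ) (μ₁ μ₂ : ℝ) : Prop where
  pos₁ : 0 < μ₁
  pos₂ : 0 < μ₂
  exists_argmax : ∀ x, ∃ y, ∀ y', F x y' ≤ F x y
  exists_argmin : ∀ y, ∃ x, ∀ x', F x y ≤ F x' y
  pl₁ : ∀ x y, 2 * μ₁ * (F x y - ⨅ x', F x' y) ≤ ‖gradX F x y‖ ^ 2
  pl₂ : ∀ x y, 2 * μ₂ * ((⨆ y', F x y') - F x y) ≤ ‖gradY F x y‖ ^ 2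

/-- The gradient variance is at most `σ²` everywhere. -/
def BoundedVariance {n dx dy : ℕ} (f : Fin n → E dx → E dy → ℝ) (σ : ℝ) : Prop :=
  ∀ x y, (1 / (n : ℝ)) * ∑ i, ‖omega (f i) x y - nu f x y‖ ^ 2 ≤ σ ^ 2

/-- The descent iterates of one epoch: start at `x`, keep `y` fixed, and in step `i + 1` use the
component with index `τ i` (indices start at `0`); constant after step `n`. -/
def xIter {n dx dy : ℕ} (f : Fin n → E dx → E dy → ℝ) (α : ℝ) (τ : Equiv.Perm (Fin n))
    (x : E dx) (y : E dy) : ℕ → E dx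
  | 0 => x
  | i + 1 =>
    if h : i < n then
      xIter f α τ x y i - α • gradX (f (τ ⟨i, h⟩)) (xIter f α τ x y i) y
    else xIter f α τ x y i

/-- The ascent iterates of one epoch: start at `y`, keep `x` fixed, and in step `i + 1` use the
component with index `π i` (indices start at `0`); constant after step `n`. -/
def yIter {n dx dy : ℕ} (f : Fin n → E dx → E dy → ℝ) (β : ℝ) (π : Equiv.Perm (Fin n))
    (x : E dx) (y : E dy) : ℕ → E dy
  | 0 => y
  | i + 1 =>
    if h : i < n then
      yIter f β π x y i + β • gradY (f (π ⟨i, h⟩)) x (yIter f β π x y i)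
    else yIter f β π x y i

/-- One epoch of alternating gradient descent ascent: a full descent pass in `x`, then a full
ascent pass in `y` at the new `x`. -/
def epoch {n dx dy : ℕ} (f : Fin n → E dx → E dy → ℝ) (α β : ℝ) (τ π : Equiv.Perm (Fin n))
    (z : E dx × E dy) : E dx × E dy :=
  (xIter f α τ z.1 z.2 n, yIter f β π (xIter f α τ z.1 z.2 n) z.2 n)

/-- The permutations `(τ_k, π_k)` of `K` epochs. -/
abbrev Shuffles (n K : ℕ) : Type := Fin K → Equiv.Perm (Fin n) × Equiv.Perm (Fin n)

/-- The point reached from `z₀` after `K` epochs that use the permutations `s`. -/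
def run {n dx dy : ℕ} (f : Fin n → E dx → E dy → ℝ) (α β : ℝ) (z₀ : E dx × E dy) :
    (K : ℕ) → Shuffles n K → E dx × E dy
  | 0, _ => z₀
  | K + 1, s =>
    epoch f α β (s (Fin.last K)).1 (s (Fin.last K)).2 (run f α β z₀ K (fun k => s k.castSucc))

/-- The value of the Lyapunov function after `K` epochs that use the permutations `s`. -/
def finalV {n dx dy : ℕ} (f : Fin n → E dx → E dy → ℝ) (lam α β : ℝ) (z₀ : E dx × E dy) (K : ℕ)
    (s : Shuffles n K) : ℝ :=
  lyapunov (objective f) lam (run f α β z₀ K s).1 (run f α β z₀ K s).2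

/-- The expectation of the Lyapunov function after `K` epochs under random reshuffling. All `2K`
permutations are independent and uniform, so their joint law is uniform on `Shuffles n K`, and the
expectation is the average over that finite set. -/
def expectedV {n dx dy : ℕ} (f : Fin n → E dx → E dy → ℝ) (lam α β : ℝ) (z₀ : E dx × E dy)
    (K : ℕ) : ℝ :=
  (1 / (Fintype.card (Shuffles n K) : ℝ)) * ∑ s : Shuffles n K, finalV f lam α β z₀ K s

/-- The ratio of the two step-sizes, `η = 73 l² / (2 μ₂²)`. -/
def eta (l μ₂ : ℝ) : ℝ := 73 * l ^ 2 / (2 * μ₂ ^ 2)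

/-- The condition number `κ = max {l/μ₁, l/μ₂}`. -/
def kappa (l μ₁ μ₂ : ℝ) : ℝ := max (l / μ₁) (l / μ₂)

/-- The largest admissible step-size, `1 / (5 η n l)`. -/
def maxStep (n : ℕ) (l μ₂ : ℝ) : ℝ := 1 / (5 * eta l μ₂ * n * l)

end AGDA

end

open scoped BigOperators

noncomputable section

namespace AGDA

/-! ### Smooth functions on a Hilbert space and the Polyak-Łojasiewicz (PL) inequality -/

section Hilbert

variable {H : Type*} [NormedAddCommGroup H] [InnerProductSpace ℝ H] [CompleteSpace H]

/-! A pass over all components is one full gradient step of length `n * α` with an inexact gradient.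
Lipschitz continuity bounds the error by the partial sums of the centred component gradients at the
start of the pass, plus a small multiple of the full gradient (`exists_pass_error`). The normalised
squares of these partial sums form the dispersion: at most `σ ^ 2 / 2` for every order, by
Cauchy-Schwarz, and at most `σ ^ 2 / (2 * n)` on average, because sampling without replacement gives
nonpositive correlations. This factor `n` separates random from adversarial shuffling.

For the inexact steps, let a = Φ(x) - Φ* and b = Φ(x) - F(x, y). PL in `y` gives quadratic growth,
so a best response lies near `y`, and it makes Φ smooth from above. A descent step therefore
contracts a, but feeds about (l²/μ₂) n α b into the estimate (`descent_step_le`). An ascent step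
contracts b at rate about μ₂ n β (`ascent_step_le`). The ratio η makes μ₂ β a large multiple of
(l²/μ₂) α, so the ascent pays for the leak and V contracts by 1 - μ₁ n α / 2 per epoch, up to a
dispersion term of order (n α)³ (`lyapunov_epoch_le`).

Unrolling this recursion, pointwise or averaged one epoch at a time, gives (i). Balancing the
exponential against the α² error gives (ii) and (iii) (`exists_tuned_step`, `tuned_error_le`). -/

theorem hasDerivAt_comp_line {g : H → ℝ} {g' : H → H} (hg : ∀ x, HasGradientAt g (g' x) x)
    (a d : H) (t : ℝ) :
    HasDerivAt (fun t : ℝ => g (a + t • d)) (inner ℝ (g' (a + t • d)) d) t := by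
  have h1 : HasDerivAt (fun t : ℝ => a + t • d) d t := by
    simpa using ((hasDerivAt_id t).smul_const d).const_add a
  have h2 := (hg (a + t • d)).hasFDerivAt.comp_hasDerivAt t h1
  simp only [InnerProductSpace.toDual_apply_apply] at h2
  exact h2

/-- The descent lemma. -/
theorem le_add_inner_add_sq {g : H → ℝ} {g' : H → H} {l : ℝ}
    (hg : ∀ x, HasGradientAt g (g' x) x) (hl : ∀ a b, ‖g' a - g' b‖ ≤ l * ‖a - b‖) (a d : H) :
    g (a + d) ≤ g a + inner ℝ (g' a) d + l / 2 * ‖d‖ ^ 2 := by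
  have hder : ∀ t : ℝ, HasDerivAt
      (fun t : ℝ => g (a + t • d) - t * inner ℝ (g' a) d - l / 2 * ‖d‖ ^ 2 * t ^ 2)
      (inner ℝ (g' (a + t • d)) d - inner ℝ (g' a) d - l * ‖d‖ ^ 2 * t) t := by
    intro t
    have h1 := ((hasDerivAt_comp_line hg a d t).sub
      ((hasDerivAt_id t).mul_const (inner ℝ (g' a) d))).sub
      (((hasDerivAt_id t).pow 2).const_mul (l / 2 * ‖d‖ ^ 2))
    refine h1.congr_deriv ?_
    simp
    ring
  -- The derivative is ⟨g'(a + t d) - g'(a), d⟩ - l t ‖d‖², nonpositive for t ≥ 0 by Cauchy-Schwarz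
  -- and the Lipschitz bound.
  have hanti : AntitoneOn
      (fun t : ℝ => g (a + t • d) - t * inner ℝ (g' a) d - l / 2 * ‖d‖ ^ 2 * t ^ 2)
      (Set.Icc 0 1) := by
    apply antitoneOn_of_deriv_nonpos (convex_Icc 0 1)
    · exact fun t _ => (hder t).continuousAt.continuousWithinAt
    · exact fun t _ => (hder t).differentiableAt.differentiableWithinAt
    · intro t ht
      rw [interior_Icc] at ht
      rw [(hder t).deriv, ← inner_sub_left]
      have h1 := real_inner_le_norm (g' (a + t • d) - g' a) d
      have h2 := hl (a + t • d) a
      rw [add_sub_cancel_left, norm_smul, Real.norm_of_nonneg ht.1.le] at h2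
      nlinarith [mul_le_mul_of_nonneg_right h2 (norm_nonneg d)]
  have := hanti (Set.left_mem_Icc.2 zero_le_one) (Set.right_mem_Icc.2 zero_le_one) zero_le_one
  simp at this
  linarith

theorem sub_sq_le_of_lipschitz_gradient {g : H → ℝ} {g' : H → H} {l : ℝ}
    (hg : ∀ x, HasGradientAt g (g' x) x) (hl : ∀ a b, ‖g' a - g' b‖ ≤ l * ‖a - b‖) (a d : H) :
    g a + inner ℝ (g' a) d - l / 2 * ‖d‖ ^ 2 ≤ g (a + d) := by
  have h := le_add_inner_add_sq (g := fun x => - g x) (g' := fun x => - g' x) (l := l)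
    (fun x => by
      have := (hg x).hasFDerivAt.neg
      rw [hasGradientAt_iff_hasFDerivAt, map_neg]
      exact this)
    (fun a b => by
      have := hl a b
      rwa [show -g' a - -g' b = -(g' a - g' b) by abel, norm_neg]) a d
  simp only [inner_neg_left] at h
  linarith

/-- Under the Polyak-Łojasiewicz inequality, the descent of `√g` reaches a zero of `g` nearby. -/
theorem exists_zero_near_of_pl [ProperSpace H] {g : H → ℝ} {g' : H → H} {μ c : ℝ}
    (hg : ∀ x, HasGradientAt g (g' x) x) (h0 : ∀ x, 0 ≤ g x)
    (hpl : ∀ x, 2 * μ * g x ≤ ‖g' x‖ ^ 2) (hc : 0 < c) (hcμ : 2 * c ^ 2 < μ) (x : H) :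
    ∃ y, g y = 0 ∧ c * dist x y ≤ √(g x) := by
  have hcont : Continuous g := continuous_iff_continuousAt.2 fun x => (hg x).continuousAt
  have hcont' : Continuous fun u => √(g u) + c * dist u x := by fun_prop
  have hcoer : Filter.Tendsto (fun u => √(g u) + c * dist u x) (Filter.cocompact H)
      Filter.atTop := by
    refine Filter.tendsto_atTop_mono (fun u => ?_)
      ((tendsto_dist_right_cocompact_atTop x).const_mul_atTop hc)
    have := Real.sqrt_nonneg (g u)
    linarith
  -- Ekeland-type argument: at a minimiser of √g + c · dist(·, x), √g cannot decrease at a rate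
  -- above c. If g were positive there, PL would give ‖∇√g‖ ≥ √(μ/2) > c.
  obtain ⟨y, hy⟩ := hcont'.exists_forall_le hcoer
  have hyx : c * dist x y ≤ √(g x) - √(g y) := by
    have := hy x
    simp only [dist_self, mul_zero, add_zero] at this
    rw [dist_comm x y]
    linarith
  refine ⟨y, ?_, hyx.trans (by linarith [Real.sqrt_nonneg (g y)])⟩
  by_contra hne
  have hpos : 0 < g y := lt_of_le_of_ne (h0 y) (Ne.symm hne)
  have hs : 0 < √(g y) := Real.sqrt_pos.2 hpos
  have hss : √(g y) ^ 2 = g y := Real.sq_sqrt hpos.le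
  have hN : 0 < ‖g' y‖ := by
    have h1 := hpl y
    have : 0 < ‖g' y‖ ^ 2 := lt_of_lt_of_le (by nlinarith [sq_nonneg c]) h1
    exact norm_pos_iff.2 fun h => by simp [h] at this
  -- The linear term bounds the growth of the distance penalty, which itself need not be
  -- differentiable.
  have hder : HasDerivAt (fun t : ℝ => √(g (y + t • (-g' y))) + t * (c * ‖g' y‖))
      ((inner ℝ (g' y) (-g' y)) / (2 * √(g y)) + c * ‖g' y‖) 0 := by
    have h1 := hasDerivAt_comp_line hg y (-g' y) 0
    have h2 := h1.sqrt (by simpa using hne)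
    have h3 := h2.add ((hasDerivAt_id (0 : ℝ)).mul_const (c * ‖g' y‖))
    refine h3.congr_deriv ?_
    simp
  have hge : 0 ≤ (inner ℝ (g' y) (-g' y)) / (2 * √(g y)) + c * ‖g' y‖ := by
    refine ge_of_tendsto hder.tendsto_slope_zero_right ?_
    filter_upwards [self_mem_nhdsWithin] with t ht
    have ht : 0 < t := ht
    have h1 := hy (y + t • (-g' y))
    have h2 := dist_triangle (y + t • (-g' y)) y x
    have h3 : dist (y + t • (-g' y)) y = t * ‖g' y‖ := by
      rw [dist_eq_norm, add_sub_cancel_left, norm_smul, norm_neg, Real.norm_of_nonneg ht.le]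
    rw [h3] at h2
    rw [smul_eq_mul]
    refine mul_nonneg (inv_nonneg.2 ht.le) ?_
    simp only [zero_add, zero_smul, add_zero, zero_mul]
    nlinarith
  rw [inner_neg_right, real_inner_self_eq_norm_sq, neg_div] at hge
  have h4 : ‖g' y‖ ^ 2 / (2 * √(g y)) ≤ c * ‖g' y‖ := by linarith
  rw [div_le_iff₀ (by positivity)] at h4
  have h5 : ‖g' y‖ ≤ 2 * c * √(g y) := by nlinarith
  have h6 : ‖g' y‖ ^ 2 ≤ 4 * c ^ 2 * g y := by
    calc ‖g' y‖ ^ 2 ≤ (2 * c * √(g y)) ^ 2 := by gcongr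
      _ = 4 * c ^ 2 * g y := by rw [mul_pow, hss]; ring
  nlinarith [hpl y]

/-- Quadratic growth from the Polyak-Łojasiewicz inequality. -/
theorem exists_zero_quadratic_growth [ProperSpace H] {g : H → ℝ} {g' : H → H} {μ : ℝ}
    (hg : ∀ x, HasGradientAt g (g' x) x) (h0 : ∀ x, 0 ≤ g x)
    (hpl : ∀ x, 2 * μ * g x ≤ ‖g' x‖ ^ 2) (hμ : 0 < μ) (x : H) :
    ∃ y, g y = 0 ∧ μ / 2 * ‖x - y‖ ^ 2 ≤ g x := by
  have hcont : Continuous g := continuous_iff_continuousAt.2 fun x => (hg x).continuousAt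
  have hsq : √(μ / 2) ^ 2 = μ / 2 := Real.sq_sqrt (by positivity)
  have hsp : 0 < √(μ / 2) := Real.sqrt_pos.2 (by positivity)
  have hcl : IsClosed {y | g y = 0} := isClosed_eq hcont continuous_const
  have key : ∀ c, 0 < c → c < √(μ / 2) → ∃ y, g y = 0 ∧ c * dist x y ≤ √(g x) := by
    intro c hc hc'
    exact exists_zero_near_of_pl hg h0 hpl hc (by nlinarith) x
  have hne : ({y | g y = 0} : Set H).Nonempty := by
    obtain ⟨y, hy, -⟩ := key (√(μ / 2) / 2) (by positivity) (by linarith)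
    exact ⟨y, hy⟩
  -- The zero in `key` depends on c; a nearest zero serves all c at once, which yields the sharp
  -- constant √(μ/2).
  obtain ⟨y, hy, hxy⟩ := hcl.exists_infDist_eq_dist hne x
  refine ⟨y, hy, ?_⟩
  have hle : √(μ / 2) * dist x y ≤ √(g x) := by
    by_contra! hlt
    have hd : 0 < dist x y := by
      by_contra! hd
      have h1 : dist x y = 0 := le_antisymm hd dist_nonneg
      rw [h1, mul_zero] at hlt
      exact absurd hlt (not_lt.2 (Real.sqrt_nonneg _))
    have h1 : √(g x) / dist x y < √(μ / 2) := (div_lt_iff₀ hd).2 hlt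
    obtain ⟨c, hc1, hc2⟩ := exists_between h1
    have hc : 0 < c := lt_of_le_of_lt (by positivity) hc1
    obtain ⟨w, hw, hxw⟩ := key c hc hc2
    have h2 : dist x y ≤ dist x w := hxy ▸ Metric.infDist_le_dist_of_mem hw
    rw [div_lt_iff₀ hd] at hc1
    nlinarith
  rw [← dist_eq_norm, ← hsq, ← mul_pow, ← Real.sq_sqrt (h0 x)]
  gcongr

end Hilbert

/-! ### Partial sums under permutations and the error of an incremental pass -/

section Dispersion

set_option linter.unusedSectionVars false

variable {H : Type*} [NormedAddCommGroup H] [InnerProductSpace ℝ H] {n : ℕ}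

/-- The normalised sum of the squared norms of the partial sums of `c` in the order `τ`. -/
def dispersion (c : Fin n → H) (τ : Equiv.Perm (Fin n)) : ℝ :=
  (1 / (n : ℝ) ^ 3) * ∑ i : Fin n, ‖∑ j ∈ Finset.Iio i, c (τ j)‖ ^ 2

theorem dispersion_nonneg (c : Fin n → H) (τ : Equiv.Perm (Fin n)) : 0 ≤ dispersion c τ := by
  unfold dispersion; positivity

theorem sum_fin_val_le (n : ℕ) : ∑ i : Fin n, (i : ℝ) ≤ (n : ℝ) ^ 2 / 2 := by
  rw [Fin.sum_univ_eq_sum_range (fun i => (i : ℝ))]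
  induction n with
  | zero => simp
  | succ n ih =>
    rw [Finset.sum_range_succ]
    push_cast
    linarith

/-- Cauchy-Schwarz bounds the squared sum of i vectors by i times the total n S; summing over i
gives n³ S / 2, whence the normalisation by n³. -/
theorem dispersion_le (hn : 0 < n) (c : Fin n → H) {S : ℝ}
    (hc : (1 / (n : ℝ)) * ∑ i, ‖c i‖ ^ 2 ≤ S) (τ : Equiv.Perm (Fin n)) :
    dispersion c τ ≤ S / 2 := by
  have hn' : (0 : ℝ) < n := by exact_mod_cast hn
  have hsum : ∑ i, ‖c i‖ ^ 2 ≤ n * S := by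
    rw [one_div, inv_mul_le_iff₀ hn'] at hc
    exact hc
  have hS : 0 ≤ S := le_trans (by positivity) hc
  have h1 : ∀ i : Fin n, ‖∑ j ∈ Finset.Iio i, c (τ j)‖ ^ 2 ≤ i * (n * S) := by
    intro i
    calc ‖∑ j ∈ Finset.Iio i, c (τ j)‖ ^ 2 ≤ (∑ j ∈ Finset.Iio i, ‖c (τ j)‖) ^ 2 := by
          gcongr; exact norm_sum_le _ _
      _ ≤ (Finset.Iio i).card * ∑ j ∈ Finset.Iio i, ‖c (τ j)‖ ^ 2 := sq_sum_le_card_mul_sum_sq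
      _ ≤ i * (n * S) := by
          rw [Fin.card_Iio]
          gcongr
          calc ∑ j ∈ Finset.Iio i, ‖c (τ j)‖ ^ 2 ≤ ∑ j, ‖c (τ j)‖ ^ 2 :=
                Finset.sum_le_sum_of_subset_of_nonneg (Finset.subset_univ _)
                  fun _ _ _ => by positivity
            _ = ∑ j, ‖c j‖ ^ 2 := Equiv.sum_comp τ fun j => ‖c j‖ ^ 2
            _ ≤ n * S := hsum
  calc dispersion c τ ≤ (1 / (n : ℝ) ^ 3) * ∑ i : Fin n, (i : ℝ) * (n * S) := by
        unfold dispersion; gcongr with i; exact h1 i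
    _ = (1 / (n : ℝ) ^ 3) * ((∑ i : Fin n, (i : ℝ)) * (n * S)) := by rw [Finset.sum_mul]
    _ ≤ (1 / (n : ℝ) ^ 3) * ((n : ℝ) ^ 2 / 2 * (n * S)) := by
        gcongr; exact sum_fin_val_le n
    _ = S / 2 := by field_simp

theorem sum_perm_apply_eq {M : Type*} [AddCommMonoid M] (φ : Fin n → M) (j k : Fin n) :
    ∑ τ : Equiv.Perm (Fin n), φ (τ j) = ∑ τ : Equiv.Perm (Fin n), φ (τ k) :=
  Fintype.sum_equiv (Equiv.mulRight (Equiv.swap j k)) _ _ fun τ => by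
    simp [Equiv.Perm.mul_apply]

/-- Negative correlation of sampling without replacement: by symmetry the sum is the same for every
k ≠ j, and summing over these k replaces the second vector by -c (τ j), since the total is zero. -/
theorem sum_perm_inner_nonpos (c : Fin n → H) (hc : ∑ i, c i = 0) {j k : Fin n} (hjk : j ≠ k) :
    ∑ τ : Equiv.Perm (Fin n), (inner ℝ (c (τ j)) (c (τ k)) : ℝ) ≤ 0 := by
  have hconst : ∀ k' ∈ Finset.univ.erase j,
      ∑ τ : Equiv.Perm (Fin n), (inner ℝ (c (τ j)) (c (τ k')) : ℝ)
        = ∑ τ : Equiv.Perm (Fin n), (inner ℝ (c (τ j)) (c (τ k)) : ℝ) := by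
    intro k' hk'
    refine Fintype.sum_equiv (Equiv.mulRight (Equiv.swap k' k)) _ _ fun τ => ?_
    have hj : Equiv.swap k' k j = j :=
      Equiv.swap_apply_of_ne_of_ne (Finset.ne_of_mem_erase hk').symm hjk
    simp [Equiv.Perm.mul_apply, hj]
  have hsum : ∑ k' ∈ Finset.univ.erase j,
      ∑ τ : Equiv.Perm (Fin n), (inner ℝ (c (τ j)) (c (τ k')) : ℝ) ≤ 0 := by
    rw [Finset.sum_comm]
    refine Finset.sum_nonpos fun τ _ => ?_
    have h1 : ∑ k' ∈ Finset.univ.erase j, c (τ k') = - c (τ j) := by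
      rw [eq_neg_iff_add_eq_zero, Finset.sum_erase_add _ _ (Finset.mem_univ j),
        Equiv.sum_comp τ c, hc]
    rw [← inner_sum, h1, inner_neg_right, real_inner_self_eq_norm_sq]
    nlinarith [sq_nonneg ‖c (τ j)‖]
  rw [Finset.sum_congr rfl hconst, Finset.sum_const, nsmul_eq_mul] at hsum
  have hpos : (0 : ℝ) < (Finset.univ.erase j).card := by
    exact_mod_cast Finset.card_pos.2 ⟨k, Finset.mem_erase.2 ⟨hjk.symm, Finset.mem_univ k⟩⟩
  exact nonpos_of_mul_nonpos_right hsum hpos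

theorem sum_perm_norm_sq (hn : 0 < n) (c : Fin n → H) (j : Fin n) :
    ∑ τ : Equiv.Perm (Fin n), ‖c (τ j)‖ ^ 2
      = Fintype.card (Equiv.Perm (Fin n)) * ((1 / (n : ℝ)) * ∑ i, ‖c i‖ ^ 2) := by
  have hn' : (0 : ℝ) < n := by exact_mod_cast hn
  have h1 : ∑ k : Fin n, ∑ τ : Equiv.Perm (Fin n), ‖c (τ k)‖ ^ 2
      = ∑ _k : Fin n, ∑ τ : Equiv.Perm (Fin n), ‖c (τ j)‖ ^ 2 :=
    Finset.sum_congr rfl fun k _ => sum_perm_apply_eq (fun i => ‖c i‖ ^ 2) k j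
  rw [Finset.sum_comm, Finset.sum_congr rfl
    (fun τ _ => Equiv.sum_comp τ fun i => ‖c i‖ ^ 2)] at h1
  simp only [Finset.sum_const, Finset.card_univ, Fintype.card_fin, nsmul_eq_mul] at h1
  field_simp
  linarith

/-- On average the cross terms of a squared partial sum may be dropped, leaving i S instead of the
worst-case i n S: a gain of a factor n. -/
theorem sum_perm_dispersion_le (hn : 0 < n) (c : Fin n → H) (h0 : ∑ i, c i = 0) {S : ℝ}
    (hc : (1 / (n : ℝ)) * ∑ i, ‖c i‖ ^ 2 ≤ S) :
    ∑ τ : Equiv.Perm (Fin n), dispersion c τ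
      ≤ Fintype.card (Equiv.Perm (Fin n)) * (S / (2 * n)) := by
  have hn' : (0 : ℝ) < n := by exact_mod_cast hn
  have hS : 0 ≤ S := le_trans (by positivity) hc
  have h1 : ∀ i : Fin n, ∑ τ : Equiv.Perm (Fin n), ‖∑ j ∈ Finset.Iio i, c (τ j)‖ ^ 2
      ≤ i * (Fintype.card (Equiv.Perm (Fin n)) * S) := by
    intro i
    calc ∑ τ : Equiv.Perm (Fin n), ‖∑ j ∈ Finset.Iio i, c (τ j)‖ ^ 2
        = ∑ j ∈ Finset.Iio i, ∑ k ∈ Finset.Iio i, ∑ τ : Equiv.Perm (Fin n),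
            (inner ℝ (c (τ j)) (c (τ k)) : ℝ) := by
          rw [Finset.sum_congr rfl fun j _ => Finset.sum_comm, Finset.sum_comm]
          refine Finset.sum_congr rfl fun τ _ => ?_
          rw [← real_inner_self_eq_norm_sq, sum_inner]
          simp_rw [inner_sum]
      _ ≤ ∑ j ∈ Finset.Iio i, ∑ τ : Equiv.Perm (Fin n), ‖c (τ j)‖ ^ 2 := by
          refine Finset.sum_le_sum fun j hj => ?_
          rw [← Finset.add_sum_erase _ _ hj]
          have h2 : ∑ k ∈ (Finset.Iio i).erase j, ∑ τ : Equiv.Perm (Fin n),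
              (inner ℝ (c (τ j)) (c (τ k)) : ℝ) ≤ 0 :=
            Finset.sum_nonpos fun k hk =>
              sum_perm_inner_nonpos c h0 (Finset.ne_of_mem_erase hk).symm
          simp_rw [real_inner_self_eq_norm_sq]
          linarith
      _ ≤ ∑ _j ∈ Finset.Iio i, (Fintype.card (Equiv.Perm (Fin n)) * S : ℝ) := by
          refine Finset.sum_le_sum fun j _ => ?_
          rw [sum_perm_norm_sq hn]
          gcongr
      _ = i * (Fintype.card (Equiv.Perm (Fin n)) * S) := by
          rw [Finset.sum_const, Fin.card_Iio, nsmul_eq_mul]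
  calc ∑ τ : Equiv.Perm (Fin n), dispersion c τ
      = (1 / (n : ℝ) ^ 3) * ∑ i : Fin n, ∑ τ : Equiv.Perm (Fin n),
          ‖∑ j ∈ Finset.Iio i, c (τ j)‖ ^ 2 := by
        unfold dispersion
        rw [← Finset.mul_sum, Finset.sum_comm]
    _ ≤ (1 / (n : ℝ) ^ 3) * ∑ i : Fin n, (i : ℝ) * (Fintype.card (Equiv.Perm (Fin n)) * S) := by
        gcongr with i; exact h1 i
    _ = (1 / (n : ℝ) ^ 3)
          * ((∑ i : Fin n, (i : ℝ)) * (Fintype.card (Equiv.Perm (Fin n)) * S)) := by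
        rw [Finset.sum_mul]
    _ ≤ (1 / (n : ℝ) ^ 3) * ((n : ℝ) ^ 2 / 2 * (Fintype.card (Equiv.Perm (Fin n)) * S)) := by
        gcongr; exact sum_fin_val_le n
    _ = Fintype.card (Equiv.Perm (Fin n)) * (S / (2 * n)) := by field_simp

/-- Drift of an incremental gradient pass away from a full gradient step. -/
theorem incremental_drift_le {h : ℕ → H → H} {x : ℕ → H} {α l : ℝ} (hα : 0 ≤ α) (hl : 0 ≤ l)
    (hx : ∀ i < n, x (i + 1) = x i - α • h i (x i))
    (hh : ∀ i < n, ∀ a b, ‖h i a - h i b‖ ≤ l * ‖a - b‖) :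
    (1 - n * α * l) * ‖∑ i ∈ Finset.range n, (h i (x i) - h i (x 0))‖
      ≤ l * α * ∑ i ∈ Finset.range n, ‖∑ j ∈ Finset.range i, h j (x 0)‖ := by
  have hx' : ∀ i ≤ n, x i - x 0 = -α • ∑ j ∈ Finset.range i, h j (x j) := by
    intro i
    induction i with
    | zero => simp
    | succ i ih =>
      intro hi
      rw [Finset.sum_range_succ, smul_add, ← ih (by omega), hx i (by omega)]
      module
  -- The total displacement R bounds itself: replacing each h j (x j) by h j (x 0) costs at most l
  -- R, so R ≤ α (sum of partial-sum norms) + n α l R. The drift is at most l R.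
  set R := ∑ i ∈ Finset.range n, ‖x i - x 0‖ with hR
  have hdist : ∀ i < n, ‖x i - x 0‖
      ≤ α * ‖∑ j ∈ Finset.range i, h j (x 0)‖ + α * l * R := by
    intro i hi
    rw [hx' i hi.le, norm_smul, norm_neg, Real.norm_of_nonneg hα, mul_assoc, ← mul_add]
    gcongr
    have h1 : ∑ j ∈ Finset.range i, h j (x j)
        = ∑ j ∈ Finset.range i, h j (x 0) + ∑ j ∈ Finset.range i, (h j (x j) - h j (x 0)) := by
      rw [← Finset.sum_add_distrib]; simp
    rw [h1]
    refine (norm_add_le _ _).trans ?_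
    gcongr
    refine (norm_sum_le _ _).trans ?_
    rw [hR, Finset.mul_sum]
    calc ∑ j ∈ Finset.range i, ‖h j (x j) - h j (x 0)‖
        ≤ ∑ j ∈ Finset.range i, l * ‖x j - x 0‖ :=
          Finset.sum_le_sum fun j hj => hh j ((Finset.mem_range.1 hj).trans hi) _ _
      _ ≤ ∑ j ∈ Finset.range n, l * ‖x j - x 0‖ :=
          Finset.sum_le_sum_of_subset_of_nonneg
            (Finset.range_subset_range.2 hi.le) fun _ _ _ => by positivity
  have hRle : R ≤ α * ∑ i ∈ Finset.range n, ‖∑ j ∈ Finset.range i, h j (x 0)‖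
      + n * (α * l * R) := by
    calc R ≤ ∑ i ∈ Finset.range n,
          (α * ‖∑ j ∈ Finset.range i, h j (x 0)‖ + α * l * R) :=
          Finset.sum_le_sum fun i hi => hdist i (Finset.mem_range.1 hi)
      _ = _ := by
        rw [Finset.sum_add_distrib, ← Finset.mul_sum, Finset.sum_const, Finset.card_range,
          nsmul_eq_mul]
  have hr : ‖∑ i ∈ Finset.range n, (h i (x i) - h i (x 0))‖ ≤ l * R := by
    refine (norm_sum_le _ _).trans ?_
    rw [hR, Finset.mul_sum]
    exact Finset.sum_le_sum fun j hj => hh j (Finset.mem_range.1 hj) _ _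
  by_cases hs : 0 ≤ 1 - n * α * l
  · calc _ ≤ (1 - n * α * l) * (l * R) := by gcongr
      _ = l * (R - n * (α * l * R)) := by ring
      _ ≤ l * (α * ∑ i ∈ Finset.range n, ‖∑ j ∈ Finset.range i, h j (x 0)‖) := by
        gcongr; linarith
      _ = _ := by ring
  · refine (mul_nonpos_of_nonpos_of_nonneg (by linarith) (norm_nonneg _)).trans ?_
    positivity

/-- A pass over all components in the order `τ` is a full gradient step with an error that the
dispersion of the component gradients controls. -/
theorem exists_pass_error (hn : 0 < n) {g : Fin n → H → H} {τ : Equiv.Perm (Fin n)} {x : ℕ → H}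
    {α l q : ℝ} (hα : 0 < α) (hl : 0 ≤ l) (hq : 0 < q) (hs : n * α * l < 1)
    (hx : ∀ i (hi : i < n), x (i + 1) = x i - α • g (τ ⟨i, hi⟩) (x i))
    (hg : ∀ i a b, ‖g i a - g i b‖ ≤ l * ‖a - b‖) {u : H}
    (hu : u = (1 / (n : ℝ)) • ∑ i, g i (x 0)) :
    ∃ r : H, x n = x 0 - (n * α) • (u + r) ∧
      (1 - n * α * l) ^ 2 * ‖r‖ ^ 2 ≤ l ^ 2 * (n * α) ^ 2 *
        ((1 + q) * dispersion (fun i => g i (x 0) - u) τ + (1 + 1 / q) / 4 * ‖u‖ ^ 2) := by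
  have hn' : (0 : ℝ) < n := by exact_mod_cast hn
  set h : ℕ → H → H := fun i a => if hi : i < n then g (τ ⟨i, hi⟩) a else 0 with hh
  have hx1 : ∀ i < n, x (i + 1) = x i - α • h i (x i) := by
    intro i hi; simp only [hh, hi, dif_pos]; exact hx i hi
  have hh1 : ∀ i < n, ∀ a b, ‖h i a - h i b‖ ≤ l * ‖a - b‖ := by
    intro i hi a b; simp only [hh, hi, dif_pos]; exact hg _ a b
  have hdrift := incremental_drift_le hα.le hl hx1 hh1
  have hsum0 : ∑ i ∈ Finset.range n, h i (x 0) = (n : ℝ) • u := by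
    rw [Finset.sum_range]
    have : ∀ i : Fin n, h i (x 0) = g (τ i) (x 0) := fun i => by simp [hh]
    simp_rw [this]
    rw [Equiv.sum_comp τ fun i => g i (x 0), hu, smul_smul, mul_one_div_cancel hn'.ne', one_smul]
  have hxn : ∀ i ≤ n, x i = x 0 - α • ∑ j ∈ Finset.range i, h j (x j) := by
    intro i
    induction i with
    | zero => simp
    | succ i ih =>
      intro hi
      rw [Finset.sum_range_succ, smul_add, hx1 i (by omega), ih (by omega)]
      abel
  -- The error r is the average change of the component gradients along the pass.
  refine ⟨(1 / (n : ℝ)) • ∑ i ∈ Finset.range n, (h i (x i) - h i (x 0)), ?_, ?_⟩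
  · rw [hxn n le_rfl, smul_add, smul_smul, Finset.sum_sub_distrib, hsum0,
      show (n : ℝ) * α * (1 / n) = α by field_simp]
    module
  · set D := ‖∑ i ∈ Finset.range n, (h i (x i) - h i (x 0))‖ with hD
    have hS : ∑ i ∈ Finset.range n, ‖∑ j ∈ Finset.range i, h j (x 0)‖
        ≤ ∑ i : Fin n, ‖∑ j ∈ Finset.Iio i, (g (τ j) (x 0) - u)‖ + (n : ℝ) ^ 2 / 2 * ‖u‖ := by
      rw [Finset.sum_range]
      calc ∑ i : Fin n, ‖∑ j ∈ Finset.range i, h j (x 0)‖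
          ≤ ∑ i : Fin n, (‖∑ j ∈ Finset.Iio i, (g (τ j) (x 0) - u)‖ + (i : ℝ) * ‖u‖) := by
            refine Finset.sum_le_sum fun i _ => ?_
            have h1 : ∑ j ∈ Finset.range i, h j (x 0) = ∑ j ∈ Finset.Iio i, g (τ j) (x 0) := by
              symm
              refine Finset.sum_bij (fun j _ => (j : ℕ)) ?_ ?_ ?_ ?_
              · intro j hj; simpa using hj
              · intro a _ b _ hab; exact Fin.ext hab
              · intro b hb
                have hb' : b < i := by simpa using hb
                exact ⟨⟨b, hb'.trans i.2⟩, by simpa [Fin.lt_def] using hb', rfl⟩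
              · intro j _; simp [hh]
            have h2 : ∑ j ∈ Finset.Iio i, g (τ j) (x 0)
                = ∑ j ∈ Finset.Iio i, (g (τ j) (x 0) - u) + (i : ℝ) • u := by
              rw [Finset.sum_sub_distrib, Finset.sum_const, Fin.card_Iio, ← Nat.cast_smul_eq_nsmul ℝ]
              simp
            rw [h1, h2]
            refine (norm_add_le _ _).trans ?_
            rw [norm_smul, Real.norm_of_nonneg (by positivity)]
        _ ≤ _ := by
            rw [Finset.sum_add_distrib, ← Finset.sum_mul]
            gcongr
            exact sum_fin_val_le n
    set P := ∑ i : Fin n, ‖∑ j ∈ Finset.Iio i, (g (τ j) (x 0) - u)‖ with hP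
    have hP0 : 0 ≤ P := by positivity
    have hPsq : P ^ 2 ≤ (n : ℝ) ^ 4 * dispersion (fun i => g i (x 0) - u) τ := by
      have h1 : P ^ 2 ≤ n * ∑ i : Fin n, ‖∑ j ∈ Finset.Iio i, (g (τ j) (x 0) - u)‖ ^ 2 := by
        have := sq_sum_le_card_mul_sum_sq (s := (Finset.univ : Finset (Fin n)))
          (f := fun i => ‖∑ j ∈ Finset.Iio i, (g (τ j) (x 0) - u)‖)
        rwa [Finset.card_univ, Fintype.card_fin] at this
      refine h1.trans (le_of_eq ?_)
      unfold dispersion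
      field_simp
    -- Young's inequality; q trades the weight of the dispersion against that of the full gradient.
    have hyoung : (P + (n : ℝ) ^ 2 / 2 * ‖u‖) ^ 2
        ≤ (1 + q) * P ^ 2 + (1 + 1 / q) / 4 * ((n : ℝ) ^ 4 * ‖u‖ ^ 2) := by
      have h1 : 0 ≤ (q * P - (n : ℝ) ^ 2 / 2 * ‖u‖) ^ 2 / q := by positivity
      have h2 : (q * P - (n : ℝ) ^ 2 / 2 * ‖u‖) ^ 2 / q
          = q * P ^ 2 - 2 * P * ((n : ℝ) ^ 2 / 2 * ‖u‖) + (1 / q) / 4 * ((n : ℝ) ^ 4 * ‖u‖ ^ 2) := by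
        field_simp
        ring
      nlinarith
    have hmain : ((1 - n * α * l) * D) ^ 2 ≤ (l * α * (P + (n : ℝ) ^ 2 / 2 * ‖u‖)) ^ 2 := by
      have h0 : 0 ≤ (1 - n * α * l) * D := mul_nonneg (by linarith) (norm_nonneg _)
      exact pow_le_pow_left₀ h0 (hdrift.trans (by gcongr)) 2
    have hnorm : ‖(1 / (n : ℝ)) • ∑ i ∈ Finset.range n, (h i (x i) - h i (x 0))‖ = D / n := by
      rw [norm_smul, Real.norm_of_nonneg (by positivity)]; ring
    rw [hnorm]
    calc (1 - n * α * l) ^ 2 * (D / n) ^ 2 = ((1 - n * α * l) * D) ^ 2 / (n : ℝ) ^ 2 := by ring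
      _ ≤ (l * α * (P + (n : ℝ) ^ 2 / 2 * ‖u‖)) ^ 2 / (n : ℝ) ^ 2 := by gcongr
      _ = (l * α) ^ 2 / (n : ℝ) ^ 2 * (P + (n : ℝ) ^ 2 / 2 * ‖u‖) ^ 2 := by ring
      _ ≤ (l * α) ^ 2 / (n : ℝ) ^ 2 * ((1 + q) * ((n : ℝ) ^ 4 *
            dispersion (fun i => g i (x 0) - u) τ)
            + (1 + 1 / q) / 4 * ((n : ℝ) ^ 4 * ‖u‖ ^ 2)) := by
          gcongr
          refine hyoung.trans ?_
          gcongr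
      _ = _ := by field_simp

end Dispersion

/-! ### Gradients of the objective and the best response function -/

section Setting

variable {n dx dy : ℕ} {f : Fin n → E dx → E dy → ℝ} {l μ₁ μ₂ σ : ℝ}

theorem norm_pair_sq (a : E dx) (b : E dy) : ‖pair a b‖ ^ 2 = ‖a‖ ^ 2 + ‖b‖ ^ 2 := by
  rw [pair, WithLp.prod_norm_sq_eq_of_L2]
  rfl

theorem norm_left_le_norm_pair (a : E dx) (b : E dy) : ‖a‖ ≤ ‖pair a b‖ := by
  have := norm_pair_sq a b
  exact le_of_sq_le_sq (by nlinarith [sq_nonneg ‖b‖]) (norm_nonneg _)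

theorem norm_right_le_norm_pair (a : E dx) (b : E dy) : ‖b‖ ≤ ‖pair a b‖ := by
  have := norm_pair_sq a b
  exact le_of_sq_le_sq (by nlinarith [sq_nonneg ‖a‖]) (norm_nonneg _)

theorem pair_sub (a a' : E dx) (b b' : E dy) : pair a b - pair a' b' = pair (a - a') (b - b') := rfl

theorem norm_pair_zero_right (a : E dx) : ‖pair a (0 : E dy)‖ = ‖a‖ := by
  have := norm_pair_sq a (0 : E dy)
  rw [norm_zero] at this
  exact (pow_left_inj₀ (norm_nonneg _) (norm_nonneg _) two_ne_zero).1 (by linarith)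

theorem norm_pair_zero_left (b : E dy) : ‖pair (0 : E dx) b‖ = ‖b‖ := by
  have := norm_pair_sq (0 : E dx) b
  rw [norm_zero] at this
  exact (pow_left_inj₀ (norm_nonneg _) (norm_nonneg _) two_ne_zero).1 (by linarith)

namespace ComponentsSmooth

variable (hf : ComponentsSmooth f l)
include hf

theorem hasGradientAt_left (i : Fin n) (x : E dx) (y : E dy) :
    HasGradientAt (fun x' => f i x' y) (gradX (f i) x y) x := by
  refine DifferentiableAt.hasGradientAt ?_
  have h1 := (hf.contDiff i).differentiable one_ne_zero
  have h2 : Differentiable ℝ fun x' : E dx => (x', y) := by fun_prop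
  exact (h1.comp h2) x

theorem hasGradientAt_right (i : Fin n) (x : E dx) (y : E dy) :
    HasGradientAt (fun y' => f i x y') (gradY (f i) x y) y := by
  refine DifferentiableAt.hasGradientAt ?_
  have h1 := (hf.contDiff i).differentiable one_ne_zero
  have h2 : Differentiable ℝ fun y' : E dy => (x, y') := by fun_prop
  exact (h1.comp h2) y

theorem norm_gradX_sub_le (i : Fin n) (x₁ x₂ : E dx) (y₁ y₂ : E dy) :
    ‖gradX (f i) x₂ y₂ - gradX (f i) x₁ y₁‖ ≤ l * ‖pair (x₂ - x₁) (y₂ - y₁)‖ := by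
  have := hf.lipschitz i x₁ y₁ x₂ y₂
  rw [omega, omega, pair_sub, pair_sub] at this
  exact (norm_left_le_norm_pair _ _).trans this

theorem norm_gradY_sub_le (i : Fin n) (x₁ x₂ : E dx) (y₁ y₂ : E dy) :
    ‖gradY (f i) x₂ y₂ - gradY (f i) x₁ y₁‖ ≤ l * ‖pair (x₂ - x₁) (y₂ - y₁)‖ := by
  have := hf.lipschitz i x₁ y₁ x₂ y₂
  rw [omega, omega, pair_sub, pair_sub] at this
  have h := (norm_right_le_norm_pair _ _).trans this
  rwa [show -gradY (f i) x₂ y₂ - -gradY (f i) x₁ y₁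
    = -(gradY (f i) x₂ y₂ - gradY (f i) x₁ y₁) by abel, norm_neg] at h

theorem hasGradientAt_objective_left (x : E dx) (y : E dy) :
    HasGradientAt (fun x' => objective f x' y) ((1 / (n : ℝ)) • ∑ i, gradX (f i) x y) x := by
  have h1 := (HasFDerivAt.fun_sum (u := Finset.univ)
    fun i _ => (hf.hasGradientAt_left i x y).hasFDerivAt).const_mul (1 / (n : ℝ))
  rw [hasGradientAt_iff_hasFDerivAt]
  simpa [objective] using h1

theorem hasGradientAt_objective_right (x : E dx) (y : E dy) :
    HasGradientAt (fun y' => objective f x y') ((1 / (n : ℝ)) • ∑ i, gradY (f i) x y) y := by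
  have h1 := (HasFDerivAt.fun_sum (u := Finset.univ)
    fun i _ => (hf.hasGradientAt_right i x y).hasFDerivAt).const_mul (1 / (n : ℝ))
  rw [hasGradientAt_iff_hasFDerivAt]
  simpa [objective] using h1

theorem gradX_objective (x : E dx) (y : E dy) :
    gradX (objective f) x y = (1 / (n : ℝ)) • ∑ i, gradX (f i) x y :=
  (hf.hasGradientAt_objective_left x y).gradient

theorem gradY_objective (x : E dx) (y : E dy) :
    gradY (objective f) x y = (1 / (n : ℝ)) • ∑ i, gradY (f i) x y :=
  (hf.hasGradientAt_objective_right x y).gradient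

theorem hasGradientAt_gradX (x : E dx) (y : E dy) :
    HasGradientAt (fun x' => objective f x' y) (gradX (objective f) x y) x := by
  rw [hf.gradX_objective]
  exact hf.hasGradientAt_objective_left x y

theorem hasGradientAt_gradY (x : E dx) (y : E dy) :
    HasGradientAt (fun y' => objective f x y') (gradY (objective f) x y) y := by
  rw [hf.gradY_objective]
  exact hf.hasGradientAt_objective_right x y

omit hf in
theorem norm_average_sub_le {H : Type*} [NormedAddCommGroup H] [NormedSpace ℝ H] (hn : 0 < n)
    (a b : Fin n → H) {D : ℝ} (h : ∀ i, ‖a i - b i‖ ≤ D) :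
    ‖(1 / (n : ℝ)) • ∑ i, a i - (1 / (n : ℝ)) • ∑ i, b i‖ ≤ D := by
  have hn' : (0 : ℝ) < n := by exact_mod_cast hn
  rw [← smul_sub, ← Finset.sum_sub_distrib, norm_smul, Real.norm_of_nonneg (by positivity)]
  have h1 : ‖∑ i, (a i - b i)‖ ≤ n * D := by
    refine (norm_sum_le _ _).trans ?_
    refine (Finset.sum_le_sum fun i _ => h i).trans ?_
    simp
  rw [one_div, inv_mul_le_iff₀ hn']
  exact h1

theorem norm_gradX_objective_sub_le (hn : 0 < n) (x₁ x₂ : E dx) (y₁ y₂ : E dy) :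
    ‖gradX (objective f) x₂ y₂ - gradX (objective f) x₁ y₁‖
      ≤ l * ‖pair (x₂ - x₁) (y₂ - y₁)‖ := by
  rw [hf.gradX_objective, hf.gradX_objective]
  exact norm_average_sub_le hn _ _ fun i => hf.norm_gradX_sub_le i x₁ x₂ y₁ y₂

theorem norm_gradY_objective_sub_le (hn : 0 < n) (x₁ x₂ : E dx) (y₁ y₂ : E dy) :
    ‖gradY (objective f) x₂ y₂ - gradY (objective f) x₁ y₁‖
      ≤ l * ‖pair (x₂ - x₁) (y₂ - y₁)‖ := by
  rw [hf.gradY_objective, hf.gradY_objective]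
  exact norm_average_sub_le hn _ _ fun i => hf.norm_gradY_sub_le i x₁ x₂ y₁ y₂

theorem nu_eq (x : E dx) (y : E dy) :
    nu f x y = pair (gradX (objective f) x y) (-gradY (objective f) x y) := by
  rw [hf.gradX_objective, hf.gradY_objective, nu]
  have h : ∀ s : Finset (Fin n), ∑ i ∈ s, omega (f i) x y
      = pair (∑ i ∈ s, gradX (f i) x y) (∑ i ∈ s, -gradY (f i) x y) := by
    intro s
    induction s using Finset.cons_induction with
    | empty => rfl
    | cons a s ha ih =>
      rw [Finset.sum_cons, Finset.sum_cons, Finset.sum_cons, ih]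
      rfl
  rw [h, Finset.sum_neg_distrib, ← smul_neg]
  rfl

theorem variance_gradX_le (hσ : BoundedVariance f σ) (x : E dx) (y : E dy) :
    (1 / (n : ℝ)) * ∑ i, ‖gradX (f i) x y - gradX (objective f) x y‖ ^ 2 ≤ σ ^ 2 := by
  refine le_trans ?_ (hσ x y)
  gcongr with i
  rw [hf.nu_eq, omega, pair_sub]
  exact norm_left_le_norm_pair _ _

theorem variance_gradY_le (hσ : BoundedVariance f σ) (x : E dx) (y : E dy) :
    (1 / (n : ℝ)) * ∑ i, ‖gradY (f i) x y - gradY (objective f) x y‖ ^ 2 ≤ σ ^ 2 := by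
  refine le_trans ?_ (hσ x y)
  gcongr with i
  rw [hf.nu_eq, omega, pair_sub, neg_sub_neg]
  rw [norm_sub_rev]
  exact norm_right_le_norm_pair _ _

end ComponentsSmooth

section BestResponse

variable {F : E dx → E dy → ℝ}

theorem TwoSidedPL.le_bestResponse (hF : TwoSidedPL F μ₁ μ₂) (x : E dx) (y : E dy) :
    F x y ≤ bestResponse F x := by
  obtain ⟨y', hy'⟩ := hF.exists_argmax x
  exact le_ciSup (f := fun y => F x y) ⟨F x y', by rintro _ ⟨w, rfl⟩; exact hy' w⟩ y

theorem minimaxValue_le (h : ∃ x y, IsMinimaxPoint F x y) (x : E dx) :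
    minimaxValue F ≤ bestResponse F x := by
  obtain ⟨x', y', h1, -⟩ := h
  exact ciInf_le ⟨bestResponse F x', by rintro _ ⟨w, rfl⟩; exact h1 w⟩ x

/-- Weak duality. -/
theorem TwoSidedPL.iInf_le_minimaxValue (hF : TwoSidedPL F μ₁ μ₂) (y : E dy) :
    ⨅ x', F x' y ≤ minimaxValue F := by
  refine le_ciInf fun x => le_trans ?_ (hF.le_bestResponse x y)
  obtain ⟨x', hx'⟩ := hF.exists_argmin y
  exact ciInf_le (f := fun x => F x y) ⟨F x' y, by rintro _ ⟨w, rfl⟩; exact hx' w⟩ x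

theorem lyapunov_nonneg (hF : TwoSidedPL F μ₁ μ₂) (h : ∃ x y, IsMinimaxPoint F x y) {lam : ℝ}
    (hlam : 0 ≤ lam) (x : E dx) (y : E dy) : 0 ≤ lyapunov F lam x y := by
  have h1 := minimaxValue_le h x
  have h2 := hF.le_bestResponse x y
  unfold lyapunov
  have : 0 ≤ lam * (bestResponse F x - F x y) := mul_nonneg hlam (by linarith)
  linarith

/-- Φ inherits PL from F(·, y) at a best response y: the values agree at x, and min F(·, y) ≤ Φ* by
weak duality. No differentiability of Φ is needed. -/
theorem TwoSidedPL.pl_bestResponse (hF : TwoSidedPL F μ₁ μ₂) {x : E dx} {y : E dy}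
    (hy : F x y = bestResponse F x) :
    2 * μ₁ * (bestResponse F x - minimaxValue F) ≤ ‖gradX F x y‖ ^ 2 := by
  refine le_trans ?_ (hF.pl₁ x y)
  have := hF.pos₁
  have := hF.iInf_le_minimaxValue y
  rw [hy]
  gcongr

end BestResponse

/-- The best response function is `l + l² / μ₂`-smooth from above. -/
theorem bestResponse_add_le (hn : 0 < n) (hf : ComponentsSmooth f l)
    (hF : TwoSidedPL (objective f) μ₁ μ₂) {x : E dx} {y : E dy}
    (hy : objective f x y = bestResponse (objective f) x) (d : E dx) :
    bestResponse (objective f) (x + d) ≤ bestResponse (objective f) x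
      + inner ℝ (gradX (objective f) x y) d + (l + l ^ 2 / μ₂) / 2 * ‖d‖ ^ 2 := by
  have hμ := hF.pos₂
  have h1 := le_add_inner_add_sq (fun x' => hf.hasGradientAt_gradX x' y) (l := l)
    (fun a b => by
      have := hf.norm_gradX_objective_sub_le hn b a y y
      rwa [sub_self, norm_pair_zero_right] at this) x d
  have h2 := hF.pl₂ (x + d) y
  have h3 : gradY (objective f) x y = 0 := by
    have hmax : IsLocalMax (fun y' => objective f x y') y :=
      Filter.Eventually.of_forall fun y' => by
        show objective f x y' ≤ objective f x y
        rw [hy]; exact hF.le_bestResponse x y'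
    have h4 := hmax.hasFDerivAt_eq_zero (hf.hasGradientAt_gradY x y).hasFDerivAt
    simpa using h4
  have h5 := hf.norm_gradY_objective_sub_le hn x (x + d) y y
  rw [h3, sub_zero, sub_self, norm_pair_zero_right, add_sub_cancel_left] at h5
  have h6 : ‖gradY (objective f) (x + d) y‖ ^ 2 ≤ l ^ 2 * ‖d‖ ^ 2 := by
    rw [← mul_pow]; gcongr
  -- The old best response y stays nearly optimal at x + d: ∇_y F vanishes at (x, y), so it is at
  -- most l ‖d‖ at (x + d, y), and PL turns this into a gap bound. With the descent lemma for F(·,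
  -- y) this replaces a Danskin-type formula.
  have h7 : bestResponse (objective f) (x + d) - objective f (x + d) y
      ≤ l ^ 2 * ‖d‖ ^ 2 / (2 * μ₂) := by
    rw [le_div_iff₀ (by positivity)]
    change 2 * μ₂ * (bestResponse (objective f) (x + d) - _) ≤ _ at h2
    linarith
  have h8 : l ^ 2 * ‖d‖ ^ 2 / (2 * μ₂) = (l ^ 2 / μ₂) / 2 * ‖d‖ ^ 2 := by field_simp
  rw [hy] at h1
  linarith

/-- Some best response to `x` is within the quadratic-growth distance of `y`. -/
theorem exists_bestResponse_near (hf : ComponentsSmooth f l)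
    (hF : TwoSidedPL (objective f) μ₁ μ₂) (x : E dx) (y : E dy) :
    ∃ y', objective f x y' = bestResponse (objective f) x ∧
      μ₂ / 2 * ‖y' - y‖ ^ 2 ≤ bestResponse (objective f) x - objective f x y := by
  obtain ⟨y', h1, h2⟩ := exists_zero_quadratic_growth (μ := μ₂)
    (g := fun y => bestResponse (objective f) x - objective f x y)
    (g' := fun y => -gradY (objective f) x y)
    (fun y => by
      have := (hf.hasGradientAt_gradY x y).hasFDerivAt.const_sub (bestResponse (objective f) x)
      rw [hasGradientAt_iff_hasFDerivAt, map_neg]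
      exact this)
    (fun y => by linarith [hF.le_bestResponse x y])
    (fun y => by rw [norm_neg]; exact hF.pl₂ x y) hF.pos₂ y
  exact ⟨y', by linarith, by rw [norm_sub_rev]; exact h2⟩

end Setting

/-! ### Inexact descent and ascent steps -/

section Epoch

variable {n dx dy : ℕ} {f : Fin n → E dx → E dy → ℝ} {l μ₁ μ₂ σ : ℝ}

/-- The real arithmetic of an inexact descent step. -/
theorem descent_arithmetic {A l k μ₁ θ W a b G2 w2 e2 r2 u2 D Q iG iu : ℝ}
    (hA : 0 < A) (hAl : A * l ≤ 2 / 365) (hAl0 : 0 ≤ A * l) (hAk : A * k ≤ 2 / 365)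
    (hθ0 : 0 ≤ θ) (hθ : θ ≤ 1 / 10) (hW : 0 ≤ W) (hG2 : 0 ≤ G2) (hw2 : 0 ≤ w2)
    (he2 : 0 ≤ e2) (hr2 : 0 ≤ r2) (hu2 : 0 ≤ u2) (hab : 0 ≤ μ₁ * a) (hkb : 0 ≤ k * b)
    (hr : r2 ≤ l ^ 2 * A ^ 2 * (1.12 * W + 3 * u2)) (hPL : 2 * μ₁ * a ≤ G2)
    (he : e2 ≤ 2 * k * b) (hGw : G2 - 2 * iG + w2 ≤ 2 * e2 + 2 * r2)
    (huw : u2 - 2 * iu + w2 = r2) (hu : u2 ≤ 2 * G2 + 2 * e2)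
    (hD : D ≤ -(A * iG) + (l + k) / 2 * (A ^ 2 * w2)) (hQ : Q ≤ A * iu + l / 2 * (A ^ 2 * w2)) :
    a + D + θ * (b + D + Q) ≤ (1 - μ₁ * A / 2) * a + (θ + 2.5 * k * A) * b
      + 1.26 * A ^ 3 * l ^ 2 * W := by
  -- Dictionary: a, b are the two gaps and k = l²/μ₂; u = ∇ₓF(x, y), G is the same gradient at a
  -- nearby best response, e = G - u, w = u + r is the direction used; D and Q are the changes Φ(x')
  -- - Φ(x) and F(x, y) - F(x', y); iG and iu are inner products with w.
  have hAl2 : l ^ 2 * A ^ 2 ≤ 1 / 30000 := by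
    have : (A * l) ^ 2 ≤ (2 / 365) ^ 2 := by gcongr
    linarith
  have hD1 : D ≤ A / 2 * (-G2 - (1 - (l + k) * A) * w2 + 2 * e2 + 2 * r2) := by
    have := mul_le_mul_of_nonneg_left hGw hA.le
    linarith
  have hQ1 : Q ≤ A / 2 * (u2 + (1 + l * A) * w2) := by
    have h1 := mul_nonneg hA.le hr2
    have h2 : A * iu = A / 2 * (u2 + w2 - r2) := by rw [← huw]; ring
    linarith
  -- The total coefficient of ‖w‖² is nonpositive for small θ and A, so all second-order terms can
  -- be dropped.
  have hwc : 0 ≤ (1 + θ) * (1 - (l + k) * A) - θ * (1 + l * A) := by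
    have h1 := mul_le_mul_of_nonneg_left hAl hθ0
    have h2 := mul_le_mul_of_nonneg_left hAk hθ0
    linarith
  have h3 : (1 + θ) * D + θ * Q ≤ A / 2 * (-G2 + u2 / 10 + 2.2 * e2 + 2.2 * r2) := by
    have e1 := mul_le_mul_of_nonneg_left hD1 (by linarith : (0 : ℝ) ≤ 1 + θ)
    have e3 := mul_le_mul_of_nonneg_left hQ1 hθ0
    have t1 := mul_nonneg hA.le (mul_nonneg hθ0 hG2)
    have t2 := mul_nonneg hA.le (mul_nonneg (by linarith : (0 : ℝ) ≤ 1 / 10 - θ) hu2)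
    have t3 := mul_nonneg hA.le
      (mul_nonneg (by linarith : (0 : ℝ) ≤ 1 / 10 - θ) (add_nonneg he2 hr2))
    have t4 := mul_nonneg hA.le (mul_nonneg hwc hw2)
    linarith
  -- Eliminates u2 through G2 and e2. Of the remaining 0.78, PL needs only 1/2; halving 2.42 · 2 and
  -- 2.464 gives values below 2.5 and 1.26.
  have h4 : -G2 + u2 / 10 + 2.2 * e2 + 2.2 * r2
      ≤ -0.78 * G2 + 2.42 * e2 + 2.464 * (l ^ 2 * A ^ 2) * W := by
    have t1 : l ^ 2 * A ^ 2 * u2 ≤ 1 / 30000 * u2 := by gcongr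
    linarith
  have h5 := mul_le_mul_of_nonneg_left h4 (by linarith : (0 : ℝ) ≤ A / 2)
  have h6 := mul_le_mul_of_nonneg_left hPL hA.le
  have h7 := mul_le_mul_of_nonneg_left he hA.le
  have h8 := mul_nonneg hA.le hab
  have h9 := mul_nonneg hA.le hkb
  have h10 : 0 ≤ A ^ 3 * l ^ 2 * W := by positivity
  linarith

/-- The real arithmetic of an inexact ascent step. -/
theorem ascent_arithmetic {B l μ₂ W b b' v2 p2 s2 iv : ℝ} (hB : 0 < B) (hBl0 : 0 ≤ B * l)
    (hBl : B * l ≤ 1 / 5) (hW : 0 ≤ W) (hv2 : 0 ≤ v2) (hp2 : 0 ≤ p2)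
    (hs : s2 ≤ l ^ 2 * B ^ 2 * (7.8125 * W + 0.49 * v2)) (hPL : 2 * μ₂ * b ≤ v2)
    (hvp : v2 - 2 * iv + p2 = s2) (hb : b' ≤ b - B * iv + l / 2 * (B ^ 2 * p2)) :
    b' ≤ (1 - 0.98 * μ₂ * B) * b + 4 * B ^ 3 * l ^ 2 * W := by
  have hBl2 : l ^ 2 * B ^ 2 ≤ 1 / 25 := by
    have : (B * l) ^ 2 ≤ (1 / 5) ^ 2 := by gcongr
    linarith
  have h1 : l ^ 2 * B ^ 2 * v2 ≤ 1 / 25 * v2 := by gcongr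
  have h2 : 0 ≤ B * ((1 - B * l) * p2) :=
    mul_nonneg hB.le (mul_nonneg (by linarith) hp2)
  have h3 : B * iv = B / 2 * (v2 + p2 - s2) := by rw [← hvp]; ring
  -- 0.49/25 < 0.02 is the loss that leaves the rate 0.98, and 7.8125/2 < 4.
  have h4 : s2 ≤ 7.8125 * (l ^ 2 * B ^ 2 * W) + 0.02 * v2 := by linarith
  have h5 := mul_le_mul_of_nonneg_left h4 hB.le
  have h6 := mul_le_mul_of_nonneg_left hPL hB.le
  have h7 : 0 ≤ B ^ 3 * l ^ 2 * W := by positivity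
  linarith

/-- Effect of an inexact descent step in `x` on the Lyapunov function. -/
theorem descent_step_le (hn : 0 < n) (hl : 0 < l) (hf : ComponentsSmooth f l)
    (hF : TwoSidedPL (objective f) μ₁ μ₂) (hmin : ∃ x y, IsMinimaxPoint (objective f) x y)
    {A θ W : ℝ} (hA : 0 < A) (hAl : A * l ≤ 2 / 365) (hAk : A * (l ^ 2 / μ₂) ≤ 2 / 365)
    (hθ0 : 0 ≤ θ) (hθ : θ ≤ 1 / 10) (hW : 0 ≤ W) (x r : E dx) (y : E dy)
    (hr : ‖r‖ ^ 2 ≤ l ^ 2 * A ^ 2 * (1.12 * W + 3 * ‖gradX (objective f) x y‖ ^ 2))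
    {x' : E dx} (hx' : x' = x - A • (gradX (objective f) x y + r)) :
    (bestResponse (objective f) x' - minimaxValue (objective f))
        + θ * (bestResponse (objective f) x' - objective f x' y)
      ≤ (1 - μ₁ * A / 2) * (bestResponse (objective f) x - minimaxValue (objective f))
        + (θ + 2.5 * (l ^ 2 / μ₂) * A) * (bestResponse (objective f) x - objective f x y)
        + 1.26 * A ^ 3 * l ^ 2 * W := by
  obtain ⟨ys, hys, hdist⟩ := exists_bestResponse_near hf hF x y
  have hμ₁ := hF.pos₁
  have hμ₂ := hF.pos₂
  set k := l ^ 2 / μ₂ with hk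
  have hk0 : 0 < k := by positivity
  set u := gradX (objective f) x y with hu
  set G := gradX (objective f) x ys with hG
  set w := u + r with hw
  set a := bestResponse (objective f) x - minimaxValue (objective f) with ha
  set b := bestResponse (objective f) x - objective f x y with hb
  have ha0 : 0 ≤ a := sub_nonneg.2 (minimaxValue_le hmin x)
  have hb0 : 0 ≤ b := sub_nonneg.2 (hF.le_bestResponse x y)
  have hx2 : x' = x + -(A • w) := by rw [hx', sub_eq_add_neg]
  have hΦ := bestResponse_add_le hn hf hF hys (-(A • w))
  have hFx := sub_sq_le_of_lipschitz_gradient (fun x' => hf.hasGradientAt_gradX x' y) (l := l)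
    (fun c d => by
      have := hf.norm_gradX_objective_sub_le hn d c y y
      rwa [sub_self, norm_pair_zero_right] at this) x (-(A • w))
  rw [← hx2, norm_neg, norm_smul, Real.norm_of_nonneg hA.le, inner_neg_right,
    real_inner_smul_right] at hΦ hFx
  have hPL : 2 * μ₁ * a ≤ ‖G‖ ^ 2 := hF.pl_bestResponse hys
  have he : ‖G - u‖ ^ 2 ≤ 2 * k * b := by
    have h1 := hf.norm_gradX_objective_sub_le hn x x y ys
    rw [sub_self, norm_pair_zero_left] at h1
    calc ‖G - u‖ ^ 2 ≤ (l * ‖ys - y‖) ^ 2 := by gcongr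
      _ = 2 * k * (μ₂ / 2 * ‖ys - y‖ ^ 2) := by rw [hk]; field_simp
      _ ≤ 2 * k * b := by gcongr
  have hGw : ‖G‖ ^ 2 - 2 * inner ℝ G w + ‖w‖ ^ 2 ≤ 2 * ‖G - u‖ ^ 2 + 2 * ‖r‖ ^ 2 := by
    rw [← norm_sub_sq_real]
    have h1 : G - w = (G - u) - r := by rw [hw]; abel
    have h2 := parallelogram_law_with_norm ℝ (G - u) r
    rw [h1]
    nlinarith [norm_nonneg ((G - u) + r)]
  have huw : ‖u‖ ^ 2 - 2 * inner ℝ u w + ‖w‖ ^ 2 = ‖r‖ ^ 2 := by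
    rw [← norm_sub_sq_real, show u - w = -r by rw [hw]; abel, norm_neg]
  have hu2 : ‖u‖ ^ 2 ≤ 2 * ‖G‖ ^ 2 + 2 * ‖G - u‖ ^ 2 := by
    have h1 : u = G - (G - u) := by abel
    have h2 := parallelogram_law_with_norm ℝ G (G - u)
    rw [← h1] at h2
    nlinarith [norm_nonneg (G + (G - u))]
  rw [mul_pow] at hΦ hFx
  have key := descent_arithmetic
    (D := bestResponse (objective f) x' - bestResponse (objective f) x)
    (Q := objective f x y - objective f x' y) hA hAl (by positivity) hAk hθ0 hθ hW
    (sq_nonneg ‖G‖) (sq_nonneg ‖w‖) (sq_nonneg ‖G - u‖) (sq_nonneg ‖r‖) (sq_nonneg ‖u‖)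
    (by positivity) (by positivity) hr hPL he hGw huw hu2 (by linarith) (by linarith)
  refine le_trans (le_of_eq ?_) key
  rw [ha, hb]
  ring

/-- Effect of an inexact ascent step in `y` on the inner gap. -/
theorem ascent_step_le (hn : 0 < n) (hl : 0 < l) (hf : ComponentsSmooth f l)
    (hF : TwoSidedPL (objective f) μ₁ μ₂) {B W : ℝ} (hB : 0 < B) (hBl : B * l ≤ 1 / 5)
    (hW : 0 ≤ W) (x : E dx) (y s : E dy)
    (hs : ‖s‖ ^ 2 ≤ l ^ 2 * B ^ 2 * (7.8125 * W + 0.49 * ‖gradY (objective f) x y‖ ^ 2))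
    {y' : E dy} (hy' : y' = y - B • (-gradY (objective f) x y + s)) :
    bestResponse (objective f) x - objective f x y'
      ≤ (1 - 0.98 * μ₂ * B) * (bestResponse (objective f) x - objective f x y)
        + 4 * B ^ 3 * l ^ 2 * W := by
  set v := gradY (objective f) x y with hv
  set p := v - s with hp
  have hy2 : y' = y + B • p := by rw [hy', hp]; module
  have hFy := sub_sq_le_of_lipschitz_gradient (fun y' => hf.hasGradientAt_gradY x y') (l := l)
    (fun c d => by
      have := hf.norm_gradY_objective_sub_le hn x x d c
      rwa [sub_self, norm_pair_zero_left] at this) y (B • p)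
  rw [← hy2, norm_smul, Real.norm_of_nonneg hB.le, real_inner_smul_right, mul_pow] at hFy
  have hPL := hF.pl₂ x y
  change 2 * μ₂ * (bestResponse (objective f) x - objective f x y) ≤ ‖v‖ ^ 2 at hPL
  have hvp : ‖v‖ ^ 2 - 2 * inner ℝ v p + ‖p‖ ^ 2 = ‖s‖ ^ 2 := by
    rw [← norm_sub_sq_real, show v - p = s by rw [hp]; abel]
  exact ascent_arithmetic hB (by positivity) hBl hW (sq_nonneg ‖v‖) (sq_nonneg ‖p‖) hs hPL hvp
    (by linarith)

end Epoch

/-! ### Contraction over one epoch and the recursion over all epochs -/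

section Epoch

variable {n dx dy : ℕ} {f : Fin n → E dx → E dy → ℝ} {l μ₁ μ₂ σ : ℝ}

/-- The dispersion of the partial gradients in `x` at `z`. -/
def dispersionX (f : Fin n → E dx → E dy → ℝ) (x : E dx) (y : E dy)
    (τ : Equiv.Perm (Fin n)) : ℝ :=
  dispersion (fun i => gradX (f i) x y - gradX (objective f) x y) τ

/-- The dispersion of the negated partial gradients in `y` at `z`. -/
def dispersionY (f : Fin n → E dx → E dy → ℝ) (x : E dx) (y : E dy)
    (π : Equiv.Perm (Fin n)) : ℝ :=
  dispersion (fun i => -gradY (f i) x y - -gradY (objective f) x y) π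

/-- Here n α l is tiny, so q = 1/10 keeps the dispersion weight near 1 at the price of a large but
harmless gradient weight: 1.1 and 2.75, divided by (363/365)², stay below 1.12 and 3. -/
theorem ComponentsSmooth.exists_xIter_error (hf : ComponentsSmooth f l) (hn : 0 < n) (hl : 0 < l)
    {α : ℝ} (hα : 0 < α) (hs : n * α * l ≤ 2 / 365) (τ : Equiv.Perm (Fin n)) (x : E dx)
    (y : E dy) :
    ∃ r, xIter f α τ x y n = x - (n * α) • (gradX (objective f) x y + r) ∧
      ‖r‖ ^ 2 ≤ l ^ 2 * (n * α) ^ 2 *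
        (1.12 * dispersionX f x y τ + 3 * ‖gradX (objective f) x y‖ ^ 2) := by
  obtain ⟨r, h1, h2⟩ := exists_pass_error (q := 1 / 10) hn
    (g := fun i x' => gradX (f i) x' y) (τ := τ) (x := xIter f α τ x y) hα hl.le (by norm_num)
    (by linarith) (fun i hi => by simp [xIter, hi])
    (fun i a b => by
      have := hf.norm_gradX_sub_le i b a y y
      rwa [sub_self, norm_pair_zero_right] at this)
    (u := gradX (objective f) x y) (hf.gradX_objective x y)
  refine ⟨r, h1, ?_⟩
  change (1 - n * α * l) ^ 2 * ‖r‖ ^ 2 ≤ l ^ 2 * (n * α) ^ 2 *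
    ((1 + 1 / 10) * dispersionX f x y τ + _) at h2
  have hW : 0 ≤ dispersionX f x y τ := dispersion_nonneg _ _
  have h3 : (363 / 365 : ℝ) ^ 2 * ‖r‖ ^ 2 ≤ (1 - n * α * l) ^ 2 * ‖r‖ ^ 2 := by
    gcongr; linarith
  have h4 : 0 ≤ l ^ 2 * (n * α) ^ 2 * dispersionX f x y τ := by positivity
  have h5 : 0 ≤ l ^ 2 * (n * α) ^ 2 * ‖gradX (objective f) x y‖ ^ 2 := by positivity
  linarith

/-- Here n β l may reach 1/5, so the gradient weight must be small: q = 4 gives 5 and 5/16, which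
divided by (4/5)² yield 7.8125 and less than 0.49. -/
theorem ComponentsSmooth.exists_yIter_error (hf : ComponentsSmooth f l) (hn : 0 < n) (hl : 0 < l)
    {β : ℝ} (hβ : 0 < β) (hs : n * β * l ≤ 1 / 5) (π : Equiv.Perm (Fin n)) (x : E dx)
    (y : E dy) :
    ∃ r, yIter f β π x y n = y - (n * β) • (-gradY (objective f) x y + r) ∧
      ‖r‖ ^ 2 ≤ l ^ 2 * (n * β) ^ 2 *
        (7.8125 * dispersionY f x y π + 0.49 * ‖gradY (objective f) x y‖ ^ 2) := by
  obtain ⟨r, h1, h2⟩ := exists_pass_error (q := 4) hn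
    (g := fun i y' => -gradY (f i) x y') (τ := π) (x := yIter f β π x y) hβ hl.le (by norm_num)
    (by linarith) (fun i hi => by simp [yIter, hi])
    (fun i a b => by
      have := hf.norm_gradY_sub_le i x x b a
      rwa [sub_self, norm_pair_zero_left, ← norm_neg, neg_sub'] at this)
    (u := -gradY (objective f) x y)
    (by rw [hf.gradY_objective x y, Finset.sum_neg_distrib, smul_neg]; rfl)
  refine ⟨r, h1, ?_⟩
  change (1 - n * β * l) ^ 2 * ‖r‖ ^ 2 ≤ l ^ 2 * (n * β) ^ 2 *
    ((1 + 4) * dispersionY f x y π + _) at h2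
  rw [norm_neg] at h2
  have hW : 0 ≤ dispersionY f x y π := dispersion_nonneg _ _
  have h3 : (4 / 5 : ℝ) ^ 2 * ‖r‖ ^ 2 ≤ (1 - n * β * l) ^ 2 * ‖r‖ ^ 2 := by
    gcongr; linarith
  have h4 : 0 ≤ l ^ 2 * (n * β) ^ 2 * dispersionY f x y π := by positivity
  have h5 : 0 ≤ l ^ 2 * (n * β) ^ 2 * ‖gradY (objective f) x y‖ ^ 2 := by positivity
  linarith

theorem eta_pos (hl : 0 < l) (hμ₂ : 0 < μ₂) : 0 < eta l μ₂ := by unfold eta; positivity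

theorem le_eta (hμ₂ : 0 < μ₂) (h : μ₂ ≤ l) : 73 / 2 ≤ eta l μ₂ := by
  unfold eta
  rw [div_le_div_iff₀ (by norm_num) (by positivity)]
  have : μ₂ ^ 2 ≤ l ^ 2 := by gcongr
  linarith

theorem maxStep_pos (hn : 0 < n) (hl : 0 < l) (hμ₂ : 0 < μ₂) : 0 < maxStep n l μ₂ := by
  have := eta_pos hl hμ₂
  have hn' : (0 : ℝ) < n := by exact_mod_cast hn
  unfold maxStep; positivity

/-- One epoch contracts the Lyapunov function up to the dispersion of the component gradients. -/
theorem lyapunov_epoch_le (hn : 0 < n) (hl : 0 < l) (hμ₁l : μ₁ ≤ l) (hμ₂l : μ₂ ≤ l)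
    (hf : ComponentsSmooth f l) (hF : TwoSidedPL (objective f) μ₁ μ₂)
    (hmin : ∃ x y, IsMinimaxPoint (objective f) x y) {α : ℝ} (hα : 0 < α)
    (hα' : α ≤ maxStep n l μ₂) (τ π : Equiv.Perm (Fin n)) (z : E dx × E dy) :
    lyapunov (objective f) (1 / 10) (epoch f α (eta l μ₂ * α) τ π z).1
        (epoch f α (eta l μ₂ * α) τ π z).2
      ≤ (1 - μ₁ * n * α / 2) * lyapunov (objective f) (1 / 10) z.1 z.2
        + 1.26 * (n * α) ^ 3 * l ^ 2 * dispersionX f z.1 z.2 τ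
        + 0.42 * (n * α) ^ 3 * l ^ 2 * eta l μ₂ ^ 3
          * dispersionY f (xIter f α τ z.1 z.2 n) z.2 π := by
  obtain ⟨x, y⟩ := z
  have hμ₁ := hF.pos₁
  have hμ₂ := hF.pos₂
  have hη := eta_pos hl hμ₂
  have hη' := le_eta hμ₂ hμ₂l
  have hn' : (0 : ℝ) < n := by exact_mod_cast hn
  have hA : 0 < n * α := by positivity
  have hstep : eta l μ₂ * (n * α) * l ≤ 1 / 5 := by
    unfold maxStep at hα'
    rw [le_div_iff₀ (by positivity)] at hα'
    linarith
  -- 2/365 is (1/5) / (73/2), from η ≥ 73/2.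
  have hAl : n * α * l ≤ 2 / 365 := by
    have : 73 / 2 * (n * α * l) ≤ eta l μ₂ * (n * α * l) := by gcongr
    linarith
  have hB : 0 < n * (eta l μ₂ * α) := by positivity
  have hBl : n * (eta l μ₂ * α) * l ≤ 1 / 5 := by linarith
  set k := l ^ 2 / μ₂ with hk
  have hηk : eta l μ₂ * μ₂ = 73 / 2 * k := by rw [hk]; unfold eta; field_simp
  have hlk : l ≤ k := by
    rw [hk, le_div_iff₀ hμ₂]; nlinarith
  have hAk : n * α * k ≤ 2 / 365 := by
    have h1 : 73 / 2 * (n * α * k) = eta l μ₂ * (n * α) * μ₂ := by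
      linear_combination -(n * α) * hηk
    have h2 : eta l μ₂ * (n * α) * μ₂ ≤ eta l μ₂ * (n * α) * l := by gcongr
    linarith
  obtain ⟨r, hr1, hr2⟩ := hf.exists_xIter_error hn hl hα hAl τ x y
  set x' := xIter f α τ x y n with hx'
  obtain ⟨s, hs1, hs2⟩ := hf.exists_yIter_error hn hl (by positivity) hBl π x' y
  have hup := ascent_step_le hn hl hf hF hB hBl (dispersion_nonneg _ _) x' y s hs2 hs1
  have hμB : μ₂ * (n * (eta l μ₂ * α)) = 73 / 2 * (k * (n * α)) := by
    linear_combination (n * α) * hηk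
  have hμB' : μ₂ * (n * (eta l μ₂ * α)) ≤ 1 / 5 := by linarith
  -- The ascent comes second, at the new x', so its contraction is absorbed beforehand into the
  -- weight θ of the intermediate gap.
  have hdown := descent_step_le hn hl hf hF hmin (θ := 1 / 10 * (1 - 0.98 * μ₂ * (n * (eta l μ₂ * α))))
    hA hAl hAk (by linarith) (by nlinarith [mul_pos hμ₂ hB]) (dispersion_nonneg _ _) x r y hr2 hr1
  change (bestResponse (objective f) x' - minimaxValue (objective f))
    + 1 / 10 * (bestResponse (objective f) x'
      - objective f x' (yIter f (eta l μ₂ * α) π x' y n)) ≤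
    (1 - μ₁ * n * α / 2) * ((bestResponse (objective f) x - minimaxValue (objective f))
    + 1 / 10 * (bestResponse (objective f) x - objective f x y))
    + 1.26 * (n * α) ^ 3 * l ^ 2 * dispersionX f x y τ
    + 0.42 * (n * α) ^ 3 * l ^ 2 * eta l μ₂ ^ 3 * dispersionY f x' y π
  have hb0 : 0 ≤ bestResponse (objective f) x - objective f x y :=
    sub_nonneg.2 (hF.le_bestResponse x y)
  have hWy : 0 ≤ (n * α) ^ 3 * l ^ 2 * eta l μ₂ ^ 3 * dispersionY f x' y π :=
    mul_nonneg (by positivity) (dispersion_nonneg _ _)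
  -- This is where η matters: the ascent gains 0.098 · 36.5 k n α > 3.5 k n α, enough for the leak
  -- 2.5 k n α and for μ₁ n α / 20, as μ₁ ≤ l ≤ k.
  have hcoef : 1 / 10 * (1 - 0.98 * μ₂ * (n * (eta l μ₂ * α))) + 2.5 * k * (n * α)
      ≤ (1 - μ₁ * n * α / 2) * (1 / 10) := by
    have h1 : μ₁ * (n * α) ≤ k * (n * α) := by gcongr; linarith
    have h2 : 0 ≤ k * (n * α) := mul_nonneg (hl.le.trans hlk) hA.le
    linarith
  have h1 := mul_le_mul_of_nonneg_right hcoef hb0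
  change _ ≤ (1 - μ₁ * (n * α) / 2) * _ + _ * _ + 1.26 * (n * α) ^ 3 * l ^ 2
    * dispersionX f x y τ at hdown
  change _ ≤ _ + 4 * (n * (eta l μ₂ * α)) ^ 3 * l ^ 2 * dispersionY f x' y π at hup
  linarith

theorem dispersionX_le (hn : 0 < n) (hf : ComponentsSmooth f l) (hσ : BoundedVariance f σ)
    (x : E dx) (y : E dy) (τ : Equiv.Perm (Fin n)) : dispersionX f x y τ ≤ σ ^ 2 / 2 :=
  dispersion_le hn _ (hf.variance_gradX_le hσ x y) τ

theorem neg_variance_gradY_le (hf : ComponentsSmooth f l) (hσ : BoundedVariance f σ)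
    (x : E dx) (y : E dy) :
    (1 / (n : ℝ)) * ∑ i, ‖-gradY (f i) x y - -gradY (objective f) x y‖ ^ 2 ≤ σ ^ 2 := by
  refine le_trans (le_of_eq ?_) (hf.variance_gradY_le hσ x y)
  congr 1
  refine Finset.sum_congr rfl fun i _ => ?_
  rw [neg_sub_neg, norm_sub_rev]

theorem dispersionY_le (hn : 0 < n) (hf : ComponentsSmooth f l) (hσ : BoundedVariance f σ)
    (x : E dx) (y : E dy) (π : Equiv.Perm (Fin n)) : dispersionY f x y π ≤ σ ^ 2 / 2 :=
  dispersion_le hn _ (neg_variance_gradY_le hf hσ x y) π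

theorem sum_dispersionX_le (hn : 0 < n) (hf : ComponentsSmooth f l) (hσ : BoundedVariance f σ)
    (x : E dx) (y : E dy) :
    ∑ τ, dispersionX f x y τ ≤ Fintype.card (Equiv.Perm (Fin n)) * (σ ^ 2 / (2 * n)) := by
  have hn' : (n : ℝ) ≠ 0 := by exact_mod_cast hn.ne'
  refine sum_perm_dispersion_le hn _ ?_ (hf.variance_gradX_le hσ x y)
  rw [Finset.sum_sub_distrib, hf.gradX_objective, Finset.sum_const, Finset.card_univ,
    Fintype.card_fin, ← Nat.cast_smul_eq_nsmul ℝ, smul_smul, mul_one_div_cancel hn', one_smul,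
    sub_self]

theorem sum_dispersionY_le (hn : 0 < n) (hf : ComponentsSmooth f l) (hσ : BoundedVariance f σ)
    (x : E dx) (y : E dy) :
    ∑ π, dispersionY f x y π ≤ Fintype.card (Equiv.Perm (Fin n)) * (σ ^ 2 / (2 * n)) := by
  have hn' : (n : ℝ) ≠ 0 := by exact_mod_cast hn.ne'
  refine sum_perm_dispersion_le hn _ ?_ (neg_variance_gradY_le hf hσ x y)
  rw [Finset.sum_sub_distrib, hf.gradY_objective, Finset.sum_const, Finset.card_univ,
    Fintype.card_fin, ← Nat.cast_smul_eq_nsmul ℝ, smul_neg, smul_smul, mul_one_div_cancel hn',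
    one_smul, Finset.sum_neg_distrib, sub_self]

/-- The contraction factor of one epoch lies in `[0, 1]`. -/
theorem contraction_nonneg (hn : 0 < n) (hl : 0 < l) (hμ₂ : 0 < μ₂) (hμ₁l : μ₁ ≤ l)
    (hμ₂l : μ₂ ≤ l) {α : ℝ} (hα : 0 < α) (hα' : α ≤ maxStep n l μ₂) :
    0 ≤ 1 - μ₁ * n * α / 2 := by
  have hη := eta_pos hl hμ₂
  have hη' := le_eta hμ₂ hμ₂l
  have hn' : (0 : ℝ) < n := by exact_mod_cast hn
  unfold maxStep at hα'
  rw [le_div_iff₀ (by positivity)] at hα'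
  have h1 : 73 / 2 * (n * α * l) ≤ eta l μ₂ * (n * α * l) := by gcongr
  have h2 : μ₁ * (n * α) ≤ l * (n * α) := by gcongr
  linarith

/-- The bound for every choice of the permutations. -/
theorem finalV_le (hn : 0 < n) (hl : 0 < l) (hμ₁l : μ₁ ≤ l) (hμ₂l : μ₂ ≤ l)
    (hf : ComponentsSmooth f l) (hF : TwoSidedPL (objective f) μ₁ μ₂)
    (hmin : ∃ x y, IsMinimaxPoint (objective f) x y) (hσ : BoundedVariance f σ) {α : ℝ}
    (hα : 0 < α) (hα' : α ≤ maxStep n l μ₂) (z : E dx × E dy) (K : ℕ) (s : Shuffles n K) :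
    finalV f (1 / 10) α (eta l μ₂ * α) z K s
      ≤ (1 - μ₁ * n * α / 2) ^ K * lyapunov (objective f) (1 / 10) z.1 z.2
        + 2 * n ^ 2 * α ^ 2 * l ^ 2 * σ ^ 2 * (2 + 3 * eta l μ₂ ^ 3) / μ₁ := by
  have hμ₁ := hF.pos₁
  have hη := eta_pos hl hF.pos₂
  have hn' : (0 : ℝ) < n := by exact_mod_cast hn
  have hq := contraction_nonneg hn hl hF.pos₂ hμ₁l hμ₂l hα hα'
  induction K with
  | zero =>
    rw [pow_zero, one_mul]
    refine le_add_of_nonneg_right (by positivity)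
  | succ K ih =>
    have h1 := lyapunov_epoch_le hn hl hμ₁l hμ₂l hf hF hmin hα hα' (s (Fin.last K)).1
      (s (Fin.last K)).2 (run f α (eta l μ₂ * α) z K (fun k => s k.castSucc))
    have h2 := mul_le_mul_of_nonneg_left (ih fun k => s k.castSucc) hq
    have h3 := mul_le_mul_of_nonneg_left (dispersionX_le hn hf hσ
      (run f α (eta l μ₂ * α) z K (fun k => s k.castSucc)).1
      (run f α (eta l μ₂ * α) z K (fun k => s k.castSucc)).2 (s (Fin.last K)).1)
      (by positivity : 0 ≤ 1.26 * (n * α) ^ 3 * l ^ 2)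
    have h4 := mul_le_mul_of_nonneg_left (dispersionY_le hn hf hσ
      (xIter f α (s (Fin.last K)).1 (run f α (eta l μ₂ * α) z K (fun k => s k.castSucc)).1
        (run f α (eta l μ₂ * α) z K (fun k => s k.castSucc)).2 n)
      (run f α (eta l μ₂ * α) z K (fun k => s k.castSucc)).2 (s (Fin.last K)).2)
      (by positivity : 0 ≤ 0.42 * (n * α) ^ 3 * l ^ 2 * eta l μ₂ ^ 3)
    -- With q the contraction factor, (1 - q) C dominates the error of one epoch, so the recursion
    -- preserves the bound q^K V + C.
    set C := 2 * n ^ 2 * α ^ 2 * l ^ 2 * σ ^ 2 * (2 + 3 * eta l μ₂ ^ 3) / μ₁ with hC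
    have h5 : μ₁ * n * α / 2 * C = (n * α) ^ 3 * l ^ 2 * σ ^ 2 * (2 + 3 * eta l μ₂ ^ 3) := by
      rw [hC]; field_simp
    have h6 : 0 ≤ (n * α) ^ 3 * l ^ 2 * σ ^ 2 := by positivity
    have h7 : 0 ≤ (n * α) ^ 3 * l ^ 2 * σ ^ 2 * eta l μ₂ ^ 3 := by positivity
    rw [pow_succ]
    unfold finalV at h2 ⊢
    rw [run]
    linarith

/-- Conditioning on the first K epochs: the last pair of permutations is averaged separately. -/
theorem sum_shuffles_succ (K : ℕ) (φ : Shuffles n (K + 1) → ℝ) :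
    ∑ s, φ s = ∑ s : Shuffles n K, ∑ p : Equiv.Perm (Fin n) × Equiv.Perm (Fin n),
      φ (Fin.snoc s p) := by
  rw [← Fintype.sum_prod_type', ← (Fin.snocEquiv fun _ => _).sum_comp, Fintype.sum_prod_type_right,
    ← Fintype.sum_prod_type']
  rfl

/-- The bound in expectation over the permutations of one epoch. -/
theorem sum_lyapunov_epoch_le (hn : 0 < n) (hl : 0 < l) (hμ₁l : μ₁ ≤ l) (hμ₂l : μ₂ ≤ l)
    (hf : ComponentsSmooth f l) (hF : TwoSidedPL (objective f) μ₁ μ₂)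
    (hmin : ∃ x y, IsMinimaxPoint (objective f) x y) (hσ : BoundedVariance f σ) {α : ℝ}
    (hα : 0 < α) (hα' : α ≤ maxStep n l μ₂) (z : E dx × E dy) :
    ∑ p : Equiv.Perm (Fin n) × Equiv.Perm (Fin n), lyapunov (objective f) (1 / 10)
        (epoch f α (eta l μ₂ * α) p.1 p.2 z).1 (epoch f α (eta l μ₂ * α) p.1 p.2 z).2
      ≤ Fintype.card (Equiv.Perm (Fin n) × Equiv.Perm (Fin n)) *
        ((1 - μ₁ * n * α / 2) * lyapunov (objective f) (1 / 10) z.1 z.2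
        + 0.21 * (n * α) ^ 3 * l ^ 2 * σ ^ 2 * (3 + eta l μ₂ ^ 3) / n) := by
  have hη := eta_pos hl hF.pos₂
  have hn' : (0 : ℝ) < n := by exact_mod_cast hn
  set N : ℝ := ((Fintype.card (Equiv.Perm (Fin n)) : ℕ) : ℝ) with hN
  have hN0 : 0 ≤ N := by positivity
  set V := lyapunov (objective f) (1 / 10) z.1 z.2 with hV
  rw [Fintype.sum_prod_type, Fintype.card_prod, Nat.cast_mul, ← hN]
  -- π is averaged first with τ fixed, since the dispersion in y is taken at the point that τ
  -- produces.
  have h1 : ∀ τ : Equiv.Perm (Fin n), ∑ π : Equiv.Perm (Fin n), lyapunov (objective f) (1 / 10)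
        (epoch f α (eta l μ₂ * α) τ π z).1 (epoch f α (eta l μ₂ * α) τ π z).2
      ≤ N * ((1 - μ₁ * n * α / 2) * V + 1.26 * (n * α) ^ 3 * l ^ 2 * dispersionX f z.1 z.2 τ
        + 0.42 * (n * α) ^ 3 * l ^ 2 * eta l μ₂ ^ 3 * (σ ^ 2 / (2 * n))) := by
    intro τ
    refine (Finset.sum_le_sum fun π _ => lyapunov_epoch_le hn hl hμ₁l hμ₂l hf hF hmin hα hα' τ π
      z).trans ?_
    rw [Finset.sum_add_distrib, Finset.sum_const, Finset.card_univ, nsmul_eq_mul, ← hN,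
      ← Finset.mul_sum]
    have h2 := mul_le_mul_of_nonneg_left
      (sum_dispersionY_le hn hf hσ (xIter f α τ z.1 z.2 n) z.2)
      (by positivity : 0 ≤ 0.42 * (n * α) ^ 3 * l ^ 2 * eta l μ₂ ^ 3)
    rw [← hN] at h2
    linarith
  refine (Finset.sum_le_sum fun τ _ => h1 τ).trans ?_
  rw [← Finset.mul_sum, Finset.sum_add_distrib, Finset.sum_add_distrib, Finset.sum_const,
    Finset.sum_const, Finset.card_univ, nsmul_eq_mul, nsmul_eq_mul, ← hN, ← Finset.mul_sum,
    mul_assoc N N]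
  refine mul_le_mul_of_nonneg_left ?_ hN0
  have h2 := mul_le_mul_of_nonneg_left (sum_dispersionX_le hn hf hσ z.1 z.2)
      (by positivity : 0 ≤ 1.26 * (n * α) ^ 3 * l ^ 2)
  rw [← hN] at h2
  have h3 : 0.21 * (n * α) ^ 3 * l ^ 2 * σ ^ 2 * (3 + eta l μ₂ ^ 3) / n
      = 1.26 * (n * α) ^ 3 * l ^ 2 * (σ ^ 2 / (2 * n))
        + 0.42 * (n * α) ^ 3 * l ^ 2 * eta l μ₂ ^ 3 * (σ ^ 2 / (2 * n)) := by
    field_simp; ring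
  rw [h3]
  linarith

/-- The bound in expectation under random reshuffling. -/
theorem expectedV_le (hn : 0 < n) (hl : 0 < l) (hμ₁l : μ₁ ≤ l) (hμ₂l : μ₂ ≤ l)
    (hf : ComponentsSmooth f l) (hF : TwoSidedPL (objective f) μ₁ μ₂)
    (hmin : ∃ x y, IsMinimaxPoint (objective f) x y) (hσ : BoundedVariance f σ) {α : ℝ}
    (hα : 0 < α) (hα' : α ≤ maxStep n l μ₂) (z : E dx × E dy) (K : ℕ) :
    expectedV f (1 / 10) α (eta l μ₂ * α) z K
      ≤ (1 - μ₁ * n * α / 2) ^ K * lyapunov (objective f) (1 / 10) z.1 z.2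
        + 0.42 * n * α ^ 2 * l ^ 2 * σ ^ 2 * (3 + eta l μ₂ ^ 3) / μ₁ := by
  have hμ₁ := hF.pos₁
  have hη := eta_pos hl hF.pos₂
  have hn' : (0 : ℝ) < n := by exact_mod_cast hn
  have hq := contraction_nonneg hn hl hF.pos₂ hμ₁l hμ₂l hα hα'
  have hcard : ∀ K, (0 : ℝ) < Fintype.card (Shuffles n K) := fun K => by
    exact_mod_cast Fintype.card_pos
  unfold expectedV
  rw [one_div, inv_mul_le_iff₀ (hcard K)]
  set C := 0.42 * n * α ^ 2 * l ^ 2 * σ ^ 2 * (3 + eta l μ₂ ^ 3) / μ₁ with hC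
  have hC1 : μ₁ * n * α / 2 * C
      = 0.21 * (n * α) ^ 3 * l ^ 2 * σ ^ 2 * (3 + eta l μ₂ ^ 3) / n := by
    rw [hC]; field_simp; ring
  have hC0 : 0 ≤ C := by positivity
  induction K with
  | zero => simpa [finalV, run] using hC0
  | succ K ih =>
    set M : ℝ := ((Fintype.card (Equiv.Perm (Fin n) × Equiv.Perm (Fin n)) : ℕ) : ℝ) with hM
    have hM0 : 0 ≤ M := by positivity
    have hMcard : (Fintype.card (Shuffles n (K + 1)) : ℝ) = M * Fintype.card (Shuffles n K) := by
      rw [hM]; simp [pow_succ]; ring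
    have hstep : ∀ s : Shuffles n K, ∑ p : Equiv.Perm (Fin n) × Equiv.Perm (Fin n),
        finalV f (1 / 10) α (eta l μ₂ * α) z (K + 1) (Fin.snoc s p)
        ≤ M * ((1 - μ₁ * n * α / 2) * finalV f (1 / 10) α (eta l μ₂ * α) z K s
          + μ₁ * n * α / 2 * C) := by
      intro s
      have h1 := sum_lyapunov_epoch_le hn hl hμ₁l hμ₂l hf hF hmin hσ hα hα'
        (run f α (eta l μ₂ * α) z K s)
      rw [← hM, ← hC1] at h1
      simpa only [finalV, run, Fin.snoc_last, Fin.snoc_castSucc] using h1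
    rw [sum_shuffles_succ, hMcard]
    refine (Finset.sum_le_sum fun s _ => hstep s).trans ?_
    rw [← Finset.mul_sum, Finset.sum_add_distrib, ← Finset.mul_sum, Finset.sum_const,
      Finset.card_univ, nsmul_eq_mul, mul_assoc M]
    refine mul_le_mul_of_nonneg_left ?_ hM0
    have h2 := mul_le_mul_of_nonneg_left ih hq
    rw [pow_succ]
    linarith

end Epoch

/-! ### Tuning the step-size -/

section Tuning

variable {n : ℕ} {l μ₁ μ₂ : ℝ}

theorem one_le_kappa (hμ₁ : 0 < μ₁) (h : μ₁ ≤ l) : 1 ≤ kappa l μ₁ μ₂ :=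
  le_max_of_le_left ((one_le_div hμ₁).2 h)

theorem eta_le_kappa_sq (hl : 0 < l) (hμ₂ : 0 < μ₂) :
    eta l μ₂ ≤ 73 / 2 * kappa l μ₁ μ₂ ^ 2 := by
  have h1 : eta l μ₂ = 73 / 2 * (l / μ₂) ^ 2 := by unfold eta; field_simp
  have h2 : l / μ₂ ≤ kappa l μ₁ μ₂ := le_max_right _ _
  rw [h1]
  gcongr

/-- The right side equals 1 / (365 (l/μ₁)(l/μ₂)²), where 365 = 5 · 73. -/
theorem le_maxStep_rate (hn : 0 < n) (hl : 0 < l) (hμ₁ : 0 < μ₁) (hμ₂ : 0 < μ₂) :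
    1 / (365 * kappa l μ₁ μ₂ ^ 3) ≤ μ₁ * n * maxStep n l μ₂ / 2 := by
  have hn' : (0 : ℝ) < n := by exact_mod_cast hn
  have h1 : μ₁ * n * maxStep n l μ₂ / 2 = 1 / (365 * ((l / μ₁) * (l / μ₂) ^ 2)) := by
    unfold maxStep eta; field_simp; norm_num
  have h2 : l / μ₂ ≤ kappa l μ₁ μ₂ := le_max_right _ _
  have h3 : l / μ₁ ≤ kappa l μ₁ μ₂ := le_max_left _ _
  rw [h1, pow_succ' (kappa l μ₁ μ₂) 2]
  have : 0 < l / μ₁ := by positivity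
  have : 0 < l / μ₂ := by positivity
  gcongr
  exact this.le.trans h2

theorem contraction_pow_le (K : ℕ) {t : ℝ} (ht : 0 ≤ 1 - t) :
    (1 - t) ^ K ≤ Real.exp (-(t * K)) := by
  calc (1 - t) ^ K ≤ Real.exp (-t) ^ K := pow_le_pow_left₀ ht (Real.one_sub_le_exp_neg t) K
    _ = Real.exp (-(t * K)) := by rw [← Real.exp_nat_mul]; ring_nf

/-- Choice of the step-size that balances the contraction against the error `P * α ^ 2`. -/
theorem exists_tuned_step (hn : 0 < n) (hl : 0 < l) (hμ₁ : 0 < μ₁) (hμ₂ : 0 < μ₂) (hμ₁l : μ₁ ≤ l)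
    (hμ₂l : μ₂ ≤ l) {K : ℕ} (hK : 1 ≤ K) {V N P Λ : ℝ} (hV : 0 ≤ V) (hN : 1 ≤ N) (hP : 0 ≤ P)
    (hΛ : Λ = Real.log (max V 1 * N * K)) :
    ∃ α : ℝ, 0 < α ∧ α ≤ maxStep n l μ₂ ∧
      (0 < Λ → α = min (maxStep n l μ₂) (4 * Λ / (μ₁ * n * K))) ∧
      (1 - μ₁ * n * α / 2) ^ K * V + P * α ^ 2
        ≤ Real.exp (-(K : ℝ) / (365 * kappa l μ₁ μ₂ ^ 3)) * V + 1 / (N ^ 2 * (K : ℝ) ^ 2)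
          + P * (4 * Λ / (μ₁ * n * K)) ^ 2 := by
  have hn' : (0 : ℝ) < n := by exact_mod_cast hn
  have hK' : (1 : ℝ) ≤ K := by exact_mod_cast hK
  have hmax := maxStep_pos hn hl hμ₂
  have hm1 : 1 ≤ max V 1 := le_max_right _ _
  have hmV : V ≤ max V 1 := le_max_left _ _
  have hκ : 1 ≤ kappa l μ₁ μ₂ := one_le_kappa hμ₁ hμ₁l
  have hX1 : 1 ≤ max V 1 * N * K := one_le_mul_of_one_le_of_one_le
    (one_le_mul_of_one_le_of_one_le hm1 hN) hK'
  have hΛ0 : 0 ≤ Λ := hΛ ▸ Real.log_nonneg hX1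
  rcases hΛ0.eq_or_lt with h0 | hpos
  -- Degenerate case Λ = 0: V ≤ 1 and N K = 1. With e the exponential, a step so small that P α² ≤ e
  -- suffices, because V + e ≤ e V + 1 is (1 - V)(1 - e) ≥ 0.
  · have hX : max V 1 * N * K = 1 := by
      rcases Real.log_eq_zero.1 (hΛ.symm.trans h0.symm) with h | h | h <;> linarith
    have hm0 : 0 < max V 1 := by linarith
    have hNK : 1 ≤ N * K := one_le_mul_of_one_le_of_one_le hN hK'
    have hV1 : V ≤ 1 := by
      calc V ≤ max V 1 := hmV
        _ ≤ max V 1 * (N * K) := le_mul_of_one_le_right hm0.le hNK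
        _ = 1 := by rw [← mul_assoc, hX]
    have hNK1 : N * K = 1 := by
      refine le_antisymm ?_ hNK
      rw [← hX, mul_assoc]
      exact le_mul_of_one_le_left (by positivity) hm1
    set e := Real.exp (-(K : ℝ) / (365 * kappa l μ₁ μ₂ ^ 3)) with he
    have he0 : 0 < e := Real.exp_pos _
    have he1 : e ≤ 1 := by
      rw [he, Real.exp_le_one_iff, neg_div]
      exact neg_nonpos.2 (by positivity)
    set α := min (maxStep n l μ₂) (min 1 (e / (P + 1))) with hα
    have hα0 : 0 < α := lt_min hmax (lt_min one_pos (by positivity))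
    have hα1 : α ≤ 1 := (min_le_right _ _).trans (min_le_left _ _)
    have hα2 : α ≤ e / (P + 1) := (min_le_right _ _).trans (min_le_right _ _)
    refine ⟨α, hα0, min_le_left _ _, fun h => absurd h0 h.ne, ?_⟩
    have h1 : P * α ^ 2 ≤ e := by
      rw [le_div_iff₀ (by positivity)] at hα2
      nlinarith [mul_nonneg hP hα0.le]
    have hq0 := contraction_nonneg hn hl hμ₂ hμ₁l hμ₂l hα0 (min_le_left _ _)
    have hq : (1 - μ₁ * n * α / 2) ^ K ≤ 1 :=
      pow_le_one₀ hq0 (by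
        have : 0 ≤ μ₁ * n * α / 2 := by positivity
        linarith)
    rw [← mul_pow, hNK1, ← h0]
    have h2 := mul_le_mul_of_nonneg_right hq hV
    nlinarith
  · set α₁ := 4 * Λ / (μ₁ * n * K) with hα₁
    have hα₁0 : 0 < α₁ := by positivity
    refine ⟨min (maxStep n l μ₂) α₁, lt_min hmax hα₁0, min_le_left _ _, fun _ => rfl, ?_⟩
    set α := min (maxStep n l μ₂) α₁ with hα
    have hα0 : 0 < α := lt_min hmax hα₁0
    have hP1 : P * α ^ 2 ≤ P * α₁ ^ 2 := by
      gcongr; exact min_le_right _ _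
    have hq0 := contraction_nonneg hn hl hμ₂ hμ₁l hμ₂l hα0 (min_le_left _ _)
    have hpow := mul_le_mul_of_nonneg_right (contraction_pow_le K hq0) hV
    have hNK0 : 0 ≤ 1 / (N ^ 2 * (K : ℝ) ^ 2) := by positivity
    have hexp0 : 0 ≤ Real.exp (-(K : ℝ) / (365 * kappa l μ₁ μ₂ ^ 3)) * V := by positivity
    have hmain : Real.exp (-(μ₁ * n * α / 2 * K)) * V
        ≤ Real.exp (-(K : ℝ) / (365 * kappa l μ₁ μ₂ ^ 3)) * V + 1 / (N ^ 2 * (K : ℝ) ^ 2) := by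
      rcases min_choice (maxStep n l μ₂) α₁ with h | h
      · have h1 : Real.exp (-(μ₁ * n * α / 2 * K))
            ≤ Real.exp (-(K : ℝ) / (365 * kappa l μ₁ μ₂ ^ 3)) := by
          rw [hα, h, Real.exp_le_exp, neg_div, neg_le_neg_iff]
          have := mul_le_mul_of_nonneg_right (le_maxStep_rate hn hl hμ₁ hμ₂)
            (by linarith : (0 : ℝ) ≤ K)
          rwa [one_div_mul_eq_div] at this
        linarith [mul_le_mul_of_nonneg_right h1 hV]
      -- The factor 4 in the step makes the exponent 2 Λ, so the exponential is (max V 1 · N K)⁻²,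
      -- which beats V / (N K)² since V ≤ (max V 1)².
      · have h1 : μ₁ * n * α / 2 * K = Λ + Λ := by
          rw [hα, h, hα₁]; field_simp; ring
        have h2 : Real.exp (-(μ₁ * n * α / 2 * K)) * V ≤ 1 / (N ^ 2 * (K : ℝ) ^ 2) := by
          rw [h1, Real.exp_neg, Real.exp_add, hΛ, Real.exp_log (by linarith),
            inv_mul_le_iff₀ (by positivity), ← div_eq_mul_one_div, le_div_iff₀ (by positivity)]
          have h3 : V ≤ max V 1 * max V 1 := by nlinarith
          calc V * (N ^ 2 * (K : ℝ) ^ 2) ≤ max V 1 * max V 1 * (N ^ 2 * (K : ℝ) ^ 2) := by gcongr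
            _ = _ := by ring
        linarith
    linarith

/-- The tuned error term in powers of the condition number. -/
theorem tuned_error_le (hl : 0 < l) (hμ₁ : 0 < μ₁) (hμ₂ : 0 < μ₂) (hμ₁l : μ₁ ≤ l)
    {a b : ℝ} (ha : 0 ≤ a) (hb : 0 ≤ b) :
    (l / μ₁) ^ 2 * (a + b * eta l μ₂ ^ 3)
      ≤ (a + b * (73 / 2) ^ 3) * kappa l μ₁ μ₂ ^ 8 := by
  have hκ : 1 ≤ kappa l μ₁ μ₂ := one_le_kappa hμ₁ hμ₁l
  have h1 : l / μ₁ ≤ kappa l μ₁ μ₂ := le_max_left _ _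
  have h2 := eta_le_kappa_sq (μ₁ := μ₁) hl hμ₂
  have h3 := eta_pos hl hμ₂
  have h4 : (1 : ℝ) ≤ kappa l μ₁ μ₂ ^ 6 := one_le_pow₀ hκ
  -- The power 8 is 2 from (l/μ₁)² plus 6 from η³, as η ≤ (73/2) κ².
  calc (l / μ₁) ^ 2 * (a + b * eta l μ₂ ^ 3)
      ≤ kappa l μ₁ μ₂ ^ 2 * (a * kappa l μ₁ μ₂ ^ 6
          + b * (73 / 2 * kappa l μ₁ μ₂ ^ 2) ^ 3) := by
        gcongr
        exact le_mul_of_one_le_right ha h4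
    _ = _ := by ring

end Tuning

end AGDA

end

/-! ### The main theorem -/

theorem theorem3 :
    ∃ c chat : ℝ, 0 < c ∧ 0 < chat ∧
      ∀ (n dx dy : ℕ) (f : Fin n → AGDA.E dx → AGDA.E dy → ℝ) (l μ₁ μ₂ σ : ℝ),
        0 < n → 0 < l → 0 < σ → μ₁ ≤ l → μ₂ ≤ l →
        AGDA.ComponentsSmooth f l →
        AGDA.TwoSidedPL (AGDA.objective f) μ₁ μ₂ →
        (∃ x y, AGDA.IsMinimaxPoint (AGDA.objective f) x y) →
        AGDA.BoundedVariance f σ →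
        ∀ (x₀ : AGDA.E dx) (y₀ : AGDA.E dy) (K : ℕ), 1 ≤ K →
          ∀ η κ lam V₀ logRR logAS : ℝ,
          η = AGDA.eta l μ₂ →
          κ = AGDA.kappa l μ₁ μ₂ →
          lam = 1 / 10 →
          V₀ = AGDA.lyapunov (AGDA.objective f) lam x₀ y₀ →
          logRR = Real.log (max V₀ 1 * Real.sqrt n * K) →
          logAS = Real.log (max V₀ 1 * K) →
          -- both algorithms, for every admissible step-size
          (∀ α : ℝ, 0 < α → α ≤ AGDA.maxStep n l μ₂ →
            AGDA.expectedV f lam α (η * α) (x₀, y₀) K ≤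
                (1 - μ₁ * n * α / 2) ^ K * V₀
                  + 0.42 * n * α ^ 2 * l ^ 2 * σ ^ 2 * (3 + η ^ 3) / μ₁ ∧
            ∀ s : AGDA.Shuffles n K,
              AGDA.finalV f lam α (η * α) (x₀, y₀) K s ≤
                (1 - μ₁ * n * α / 2) ^ K * V₀
                  + 2 * n ^ 2 * α ^ 2 * l ^ 2 * σ ^ 2 * (2 + 3 * η ^ 3) / μ₁) ∧
          -- random reshuffling, with the tuned step-size
          (∃ α : ℝ, 0 < α ∧ α ≤ AGDA.maxStep n l μ₂ ∧
            (0 < logRR → α = min (AGDA.maxStep n l μ₂) (4 * logRR / (μ₁ * n * K))) ∧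
            AGDA.expectedV f lam α (η * α) (x₀, y₀) K ≤
              Real.exp (-(K : ℝ) / (365 * κ ^ 3)) * V₀
                + (μ₁ + c * κ ^ 8 * σ ^ 2 * logRR ^ 2) / (μ₁ * n * (K : ℝ) ^ 2)) ∧
          -- adversarial shuffling, with the tuned step-size
          (∃ α : ℝ, 0 < α ∧ α ≤ AGDA.maxStep n l μ₂ ∧
            (0 < logAS → α = min (AGDA.maxStep n l μ₂) (4 * logAS / (μ₁ * n * K))) ∧
            ∀ s : AGDA.Shuffles n K,
              AGDA.finalV f lam α (η * α) (x₀, y₀) K s ≤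
                Real.exp (-(K : ℝ) / (365 * κ ^ 3)) * V₀
                  + (μ₁ + chat * κ ^ 8 * σ ^ 2 * logAS ^ 2) / (μ₁ * (K : ℝ) ^ 2)) := by
  -- Each constant is the prefactor in (i), times 16 from the squared step 4 Λ / (μ₁ n K), times the
  -- coefficient of κ⁸.
  refine ⟨0.42 * 16 * (3 + 1 * (73 / 2) ^ 3), 2 * 16 * (2 + 3 * (73 / 2) ^ 3), by norm_num,
    by norm_num, ?_⟩
  intro n dx dy f l μ₁ μ₂ σ hn hl _ hμ₁l hμ₂l hf hF hmin hσ x₀ y₀ K hK η κ lam V₀ logRR logAS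
    hη hκ hlam hV₀ hRR hAS
  subst hη hκ hlam
  have hμ₁ := hF.pos₁
  have hμ₂ := hF.pos₂
  have hn' : (0 : ℝ) < n := by exact_mod_cast hn
  have hn1 : (1 : ℝ) ≤ n := by exact_mod_cast hn
  have hK' : (0 : ℝ) < K := by exact_mod_cast hK
  have hηp := AGDA.eta_pos hl hμ₂
  have hV0 : 0 ≤ V₀ := hV₀ ▸ AGDA.lyapunov_nonneg hF hmin (by norm_num) x₀ y₀
  have bRR := fun {α : ℝ} (hα : 0 < α) (hα' : α ≤ AGDA.maxStep n l μ₂) =>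
    AGDA.expectedV_le hn hl hμ₁l hμ₂l hf hF hmin hσ hα hα' (x₀, y₀) K
  have bAS := fun {α : ℝ} (hα : 0 < α) (hα' : α ≤ AGDA.maxStep n l μ₂) =>
    AGDA.finalV_le hn hl hμ₁l hμ₂l hf hF hmin hσ hα hα' (x₀, y₀) K
  simp only [← hV₀] at bRR bAS
  refine ⟨fun α hα hα' => ⟨bRR hα hα', bAS hα hα'⟩, ?_, ?_⟩
  -- N = √n here, so that 1/(N K)² is 1/(n K²); the adversarial case takes N = 1.
  · obtain ⟨α, hα, hα', hmin', hle⟩ := AGDA.exists_tuned_step hn hl hμ₁ hμ₂ hμ₁l hμ₂l hK hV0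
      (Real.one_le_sqrt.2 hn1)
      (P := 0.42 * n * l ^ 2 * σ ^ 2 * (3 + AGDA.eta l μ₂ ^ 3) / μ₁) (by positivity) hRR
    refine ⟨α, hα, hα', hmin', (bRR hα hα').trans ?_⟩
    rw [Real.sq_sqrt hn'.le] at hle
    have herr := mul_le_mul_of_nonneg_left
      (AGDA.tuned_error_le hl hμ₁ hμ₂ hμ₁l (by norm_num : (0 : ℝ) ≤ 3) zero_le_one)
      (by positivity : 0 ≤ 0.42 * 16 * σ ^ 2 * logRR ^ 2 / (μ₁ * n * (K : ℝ) ^ 2))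
    have h1 : 0.42 * n * l ^ 2 * σ ^ 2 * (3 + AGDA.eta l μ₂ ^ 3) / μ₁
        * (4 * logRR / (μ₁ * n * K)) ^ 2
        = 0.42 * 16 * σ ^ 2 * logRR ^ 2 / (μ₁ * n * (K : ℝ) ^ 2)
          * ((l / μ₁) ^ 2 * (3 + 1 * AGDA.eta l μ₂ ^ 3)) := by
      field_simp; ring
    rw [h1] at hle
    have h2 : ∀ t : ℝ, (μ₁ + t) / (μ₁ * n * (K : ℝ) ^ 2)
        = 1 / (n * (K : ℝ) ^ 2) + t / (μ₁ * n * (K : ℝ) ^ 2) := fun t => by field_simp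
    rw [h2]
    calc _ = (1 - μ₁ * n * α / 2) ^ K * V₀
          + 0.42 * n * l ^ 2 * σ ^ 2 * (3 + AGDA.eta l μ₂ ^ 3) / μ₁ * α ^ 2 := by ring
      _ ≤ _ := hle.trans (add_le_add_right herr _)
      _ = _ := by ring
  · obtain ⟨α, hα, hα', hmin', hle⟩ := AGDA.exists_tuned_step hn hl hμ₁ hμ₂ hμ₁l hμ₂l hK hV0
      le_rfl (Λ := logAS) (P := 2 * n ^ 2 * l ^ 2 * σ ^ 2 * (2 + 3 * AGDA.eta l μ₂ ^ 3) / μ₁) (by positivity)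
      (by rwa [mul_one])
    refine ⟨α, hα, hα', hmin', fun s => (bAS hα hα' s).trans ?_⟩
    rw [one_pow, one_mul] at hle
    have herr := mul_le_mul_of_nonneg_left
      (AGDA.tuned_error_le hl hμ₁ hμ₂ hμ₁l (by norm_num : (0 : ℝ) ≤ 2)
        (by norm_num : (0 : ℝ) ≤ 3))
      (by positivity : 0 ≤ 2 * 16 * σ ^ 2 * logAS ^ 2 / (μ₁ * (K : ℝ) ^ 2))
    have h1 : 2 * n ^ 2 * l ^ 2 * σ ^ 2 * (2 + 3 * AGDA.eta l μ₂ ^ 3) / μ₁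
        * (4 * logAS / (μ₁ * n * K)) ^ 2
        = 2 * 16 * σ ^ 2 * logAS ^ 2 / (μ₁ * (K : ℝ) ^ 2)
          * ((l / μ₁) ^ 2 * (2 + 3 * AGDA.eta l μ₂ ^ 3)) := by
      field_simp; ring
    rw [h1] at hle
    have h2 : ∀ t : ℝ, (μ₁ + t) / (μ₁ * (K : ℝ) ^ 2)
        = 1 / (K : ℝ) ^ 2 + t / (μ₁ * (K : ℝ) ^ 2) := fun t => by field_simp
    rw [h2]
    calc _ = (1 - μ₁ * n * α / 2) ^ K * V₀
          + 2 * n ^ 2 * l ^ 2 * σ ^ 2 * (2 + 3 * AGDA.eta l μ₂ ^ 3) / μ₁ * α ^ 2 := by ring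
      _ ≤ _ := hle.trans (add_le_add_right herr _)
      _ = _ := by ring
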